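/- Let $1<k\le n/2$. Let $B=B_{k,n}$ be the completed algebra over $\mathbb C$ of the quiver with vertex set $\mathbb Z/n$ and arrows $x_i\colon i-1\to i$, $y_i\colon i\to i-1$ $(i\in\mathbb Z/n)$, subject to the relations $xy=yx$ and $x^k=y^{n-k}$ at every vertex; its centre is $Z=\mathbb C[[t]]$ with $t=\sum_i x_iy_i$, and $\mathrm{CM}(B)$ is the category of $B$-modules that are free of finite rank over $Z$. The rank of $M\in\mathrm{CM}(B)$ is the rank over $Z$ of $e_iM$, for any vertex idempotent $e_i$. For a $k$-subset $I$ of $\mathbb Z/n$ (identified with $\{1,\dots,n\}$), $L_I$ is the rank $1$ module with $\mathbb C[[t]]$ at every vertex on which $x_i,y_i$ act by $1,t$ if $i\in I$ and by $t,1$ if $i\notin I$. A module $M$ has profile $I|J$ if there is a short exact sequence of $B$-modules $0\to L_J\to M\to L_I\to 0$; then $\underline a(M)\in\mathbb Z^n$ is the vector whose $i$-th entry is the multiplicity of $i$ in the multiset union of $I$ and $J$. Let $J_{k,n}$ be the tree with nodes $1,\dots,n$ consisting of the path $1-2-\cdots-(n-1)$ and an edge between $n$ and $k$. Identify its root lattice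 with a sublattice of $\mathbb Z^n$ by $\alpha_i\leftrightarrow -e_i+e_{i+1}$ $(1\le i\le n-1)$ and $\beta=\alpha_n\leftrightarrow e_1+\dots+e_k$. One says that $M$ corresponds to a real root if $\underline a(M)$ corresponds to a real root, that is, to an element of the Weyl group orbit of a simple root. Let $q(\underline a)=\sum_i a_i^2+\frac{2-k}{k^2}\bigl(\sum_i a_i\bigr)^2$. Let $\Gamma$ be the cylindrical cover of the quiver: the quotient of $\mathbb Z^2$, with arrows $x\colon p\to p+(1,0)$ and $y\colon p\to p+(0,1)$, by translation by $(k,k-n)$, where $(a,b)$ lies over the vertex $a-b$. A complete poset representation $W$ of $\Gamma$ in $\mathbb C^2$ assigns a subspace of $\mathbb C^2$ to each vertex of $\Gamma$ such that arrows are inclusions and, over each vertex of the quiver, the subspaces are eventually $0$ in one direction and eventually $\mathbb C^2$ in the other. It gives a rank $2$ module in $\mathrm{CM}(B)$ whose component at a vertex $i$ is the product of the spaces $W(p)$, $p$ over $i$, with $x,y$ acting along the arrows of $\Gamma$. A rank $2$ module $M$ has poset $(1^r,2)$ if it is isomorphic to the module of such a $W$ for which the full subgraph of $\Gamma$ on $\{p:\dim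 W(p)=1\}$ has exactly $r$ connected components. **Proposition.** Let $M\in\mathrm{CM}(B_{k,n})$ be an indecomposable module of rank $2$ with profile $I|J$. 1. If $M$ corresponds to a real root of $J_{k,n}$, then $|I\cap J|=k-3$ and $M$ has poset $(1^3,2)$. 2. If $|I\cap J|=k-3-m$ with $m\in\mathbb Z$, then $q(\underline a(M))=2-2m$. -/

import Mathlib

open scoped PowerSeries LaurentSeries

namespace GrassmannianCM

/-! ## Modules over `B_{k,n}` -/

/-- A `B_{k,n}`-module structure on a module `M` over the centre `Z = ℂ⟦t⟧` of `B_{k,n}`.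
The vertices of the circular quiver are the elements of `ℤ/n` (with `0` in the role of `n`);
`e i` are the vertex idempotents, so that `M = ⨁ i, e i M`; `x` is the sum of the clockwise arrows
`x_i : i - 1 → i` and `y` is the sum of the anticlockwise arrows `y_i : i → i - 1`.
The relations are `xy = yx`, `x^k = y^(n-k)`, and `t = ∑ x_i y_i` is the parameter of `Z`. -/
structure BAction (k n : ℕ) [NeZero n] (M : Type*) [AddCommGroup M] [Module ℂ⟦X⟧ M] where
  e : ZMod n → Module.End ℂ⟦X⟧ M
  x : Module.End ℂ⟦X⟧ M
  y : Module.End ℂ⟦X⟧ M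
  e_mul_e : ∀ i j, e i * e j = if i = j then e i else 0
  sum_e : ∑ i, e i = 1
  x_mul_e : ∀ i, x * e i = e (i + 1) * x
  y_mul_e : ∀ i, y * e i = e (i - 1) * y
  x_mul_y : x * y = (PowerSeries.X : ℂ⟦X⟧) • (1 : Module.End ℂ⟦X⟧ M)
  y_mul_x : y * x = (PowerSeries.X : ℂ⟦X⟧) • (1 : Module.End ℂ⟦X⟧ M)
  x_pow : x ^ k = y ^ (n - k)

namespace BAction

variable {k n : ℕ} [NeZero n] {M N : Type*} [AddCommGroup M] [Module ℂ⟦X⟧ M]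
  [AddCommGroup N] [Module ℂ⟦X⟧ N]

/-- A `Z`-linear map is a homomorphism of `B_{k,n}`-modules. -/
def IsHom (A : BAction k n M) (A' : BAction k n N) (f : M →ₗ[ℂ⟦X⟧] N) : Prop :=
  (∀ i v, f (A.e i v) = A'.e i (f v)) ∧ (∀ v, f (A.x v) = A'.x (f v)) ∧
    ∀ v, f (A.y v) = A'.y (f v)

/-- A `Z`-submodule is a `B_{k,n}`-submodule. -/
def IsStable (A : BAction k n M) (P : Submodule ℂ⟦X⟧ M) : Prop :=
  (∀ i, ∀ v ∈ P, A.e i v ∈ P) ∧ (∀ v ∈ P, A.x v ∈ P) ∧ ∀ v ∈ P, A.y v ∈ P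

/-- Indecomposability: nonzero, and not a direct sum of two nonzero `B_{k,n}`-submodules. -/
def IsIndecomposable (A : BAction k n M) : Prop :=
  Nontrivial M ∧ ∀ P Q : Submodule ℂ⟦X⟧ M, A.IsStable P → A.IsStable Q → IsCompl P Q →
    P = ⊥ ∨ Q = ⊥

/-- The rank of a Cohen-Macaulay module (one that is free of finite rank over `Z`) is the common
rank over `Z` of the vertex components `e i M`. -/
def HasRank (A : BAction k n M) (r : ℕ) : Prop :=
  ∀ i, Module.finrank ℂ⟦X⟧ (LinearMap.range (A.e i)) = r

end BAction

/-! ## Rank one modules and profiles -/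

section RankOne

variable {n : ℕ}

/-- The arrow `x_i` of `L_I` is multiplication by this scalar. -/
noncomputable def xScalar (I : Finset (ZMod n)) (i : ZMod n) : ℂ⟦X⟧ :=
  if i ∈ I then 1 else PowerSeries.X

/-- The arrow `y_i` of `L_I` is multiplication by this scalar. -/
noncomputable def yScalar (I : Finset (ZMod n)) (i : ZMod n) : ℂ⟦X⟧ :=
  if i ∈ I then PowerSeries.X else 1

/-- The action of `x` on `L_I = ⨁ i, U_i`, `U_i = ℂ⟦t⟧`. -/
noncomputable def rankOneX (I : Finset (ZMod n)) : Module.End ℂ⟦X⟧ (ZMod n → ℂ⟦X⟧) where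
  toFun f i := xScalar I i * f (i - 1)
  map_add' f g := by ext1 i; simp [mul_add]
  map_smul' c f := by ext1 i; simp [mul_left_comm]

/-- The action of `y` on `L_I`. -/
noncomputable def rankOneY (I : Finset (ZMod n)) : Module.End ℂ⟦X⟧ (ZMod n → ℂ⟦X⟧) where
  toFun f i := yScalar I (i + 1) * f (i + 1)
  map_add' f g := by ext1 i; simp [mul_add]
  map_smul' c f := by ext1 i; simp [mul_left_comm]

/-- The projection of `L_I` to `U_i`. -/
noncomputable def rankOneE (i : ZMod n) : Module.End ℂ⟦X⟧ (ZMod n → ℂ⟦X⟧) where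
  toFun f j := if j = i then f j else 0
  map_add' f g := by ext1 j; by_cases h : j = i <;> simp [h]
  map_smul' c f := by ext1 j; by_cases h : j = i <;> simp [h]

theorem rankOneX_pow_apply (I : Finset (ZMod n)) (m : ℕ) (f : ZMod n → ℂ⟦X⟧) (i : ZMod n) :
    ((rankOneX I) ^ m) f i = (∏ j ∈ Finset.range m, xScalar I (i - j)) * f (i - m) := by
  induction m generalizing i with
  | zero => simp
  | succ m ih =>
    rw [pow_succ', Module.End.mul_apply]
    change xScalar I i * ((rankOneX I ^ m) f (i - 1)) = _
    rw [ih, Finset.prod_range_succ', ← mul_assoc, mul_comm (xScalar I i)]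
    congr 1
    · congr 1
      · refine Finset.prod_congr rfl fun j _ => ?_
        congr 1; push_cast; ring
      · simp
    · congr 1; push_cast; ring

theorem rankOneY_pow_apply (I : Finset (ZMod n)) (m : ℕ) (f : ZMod n → ℂ⟦X⟧) (i : ZMod n) :
    ((rankOneY I) ^ m) f i = (∏ j ∈ Finset.range m, yScalar I (i + 1 + j)) * f (i + m) := by
  induction m generalizing i with
  | zero => simp
  | succ m ih =>
    rw [pow_succ', Module.End.mul_apply]
    change yScalar I (i + 1) * ((rankOneY I ^ m) f (i + 1)) = _
    rw [ih, Finset.prod_range_succ', ← mul_assoc, mul_comm (yScalar I (i + 1))]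
    congr 1
    · congr 1
      · refine Finset.prod_congr rfl fun j _ => ?_
        congr 1; push_cast; ring
      · simp
    · congr 1; push_cast; ring

variable [NeZero n]

theorem prod_all (g : ZMod n → ℂ⟦X⟧) (a : ZMod n) :
    ∏ j ∈ Finset.range n, g (a + j) = ∏ i, g i := by
  refine Finset.prod_bij (fun j _ => a + (j : ZMod n)) (by simp) ?_ ?_ (by simp)
  · intro j hj l hl h
    have h' := add_left_cancel h
    rw [ZMod.natCast_eq_natCast_iff'] at h'
    rwa [Nat.mod_eq_of_lt (Finset.mem_range.1 hj), Nat.mod_eq_of_lt (Finset.mem_range.1 hl)] at h'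
  · intro b _
    exact ⟨(b - a).val, Finset.mem_range.2 (ZMod.val_lt _), by simp⟩

theorem prod_xScalar_eq (I : Finset (ZMod n)) {k : ℕ} (hI : I.card = k) (hk : k ≤ n)
    (i : ZMod n) :
    ∏ j ∈ Finset.range k, xScalar I (i - j) =
      ∏ j ∈ Finset.range (n - k), yScalar I (i + 1 + j) := by
  have hx : ∏ j ∈ Finset.range k, xScalar I (i - j) =
      ∏ j ∈ Finset.range k, xScalar I (i + 1 + ((n - k : ℕ) : ZMod n) + j) := by
    rw [← Finset.prod_range_reflect]
    refine Finset.prod_congr rfl fun j hj => ?_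
    have hj' := Finset.mem_range.1 hj
    congr 1
    rw [Nat.cast_sub (by omega), Nat.cast_sub (by omega), Nat.cast_sub hk]
    simp; ring
  have hy : (∏ j ∈ Finset.range (n - k), yScalar I (i + 1 + j)) *
      ∏ j ∈ Finset.range k, yScalar I (i + 1 + ((n - k : ℕ) : ZMod n) + j) =
        (PowerSeries.X : ℂ⟦X⟧) ^ k := by
    have h1 := Finset.prod_range_add (fun j : ℕ => yScalar I (i + 1 + (j : ZMod n))) (n - k) k
    rw [Nat.sub_add_cancel hk, prod_all] at h1
    have h2 : ∏ c, yScalar I c = (PowerSeries.X : ℂ⟦X⟧) ^ k := by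
      simp [yScalar, hI]
    rw [h2] at h1
    rw [h1]
    congr 1
    refine Finset.prod_congr rfl fun j _ => ?_
    congr 1; push_cast; ring
  have hxy : (∏ j ∈ Finset.range k, xScalar I (i + 1 + ((n - k : ℕ) : ZMod n) + j)) *
      ∏ j ∈ Finset.range k, yScalar I (i + 1 + ((n - k : ℕ) : ZMod n) + j) =
        (PowerSeries.X : ℂ⟦X⟧) ^ k := by
    rw [← Finset.prod_mul_distrib, Finset.prod_eq_pow_card (b := (PowerSeries.X : ℂ⟦X⟧))]
    · simp
    · intro j _
      unfold xScalar yScalar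
      split_ifs <;> simp
  rw [hx]
  refine mul_right_cancel₀ (b := ∏ j ∈ Finset.range k,
    yScalar I (i + 1 + ((n - k : ℕ) : ZMod n) + j)) ?_ (hxy.trans hy.symm)
  intro h0
  rw [h0, mul_zero] at hxy
  exact pow_ne_zero k PowerSeries.X_ne_zero hxy.symm

/-- The rank one module `L_I` attached to a `k`-subset `I` of `ℤ/n`: `U_i = ℂ⟦t⟧` at every vertex,
`x_i` is `1` and `y_i` is `t` for `i ∈ I`, and `x_i` is `t` and `y_i` is `1` for `i ∉ I`. -/
noncomputable def rankOne {k : ℕ} (hk : k ≤ n) (I : Finset (ZMod n)) (hI : I.card = k) :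
    BAction k n (ZMod n → ℂ⟦X⟧) where
  e := rankOneE
  x := rankOneX I
  y := rankOneY I
  e_mul_e i j := by
    refine LinearMap.ext fun f => funext fun l => ?_
    by_cases h : i = j
    · subst h
      by_cases h1 : l = i <;> simp [rankOneE, h1]
    · by_cases h1 : l = i
      · subst h1; simp [rankOneE, h]
      · simp [rankOneE, h, h1]
  sum_e := by
    refine LinearMap.ext fun f => funext fun l => ?_
    simp [LinearMap.sum_apply, rankOneE]
  x_mul_e i := by
    refine LinearMap.ext fun f => funext fun l => ?_
    by_cases h : l = i + 1
    · simp [rankOneE, rankOneX, h]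
    · have h' : l - 1 ≠ i := fun h1 => h (sub_eq_iff_eq_add.1 h1)
      simp [rankOneE, rankOneX, h, h']
  y_mul_e i := by
    refine LinearMap.ext fun f => funext fun l => ?_
    by_cases h : l = i - 1
    · simp [rankOneE, rankOneY, h]
    · have h' : l + 1 ≠ i := fun h1 => h (eq_sub_iff_add_eq.2 h1)
      simp [rankOneE, rankOneY, h, h']
  x_mul_y := by
    refine LinearMap.ext fun f => funext fun l => ?_
    by_cases h : l ∈ I <;> simp [rankOneX, rankOneY, xScalar, yScalar, h]
  y_mul_x := by
    refine LinearMap.ext fun f => funext fun l => ?_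
    by_cases h : l + 1 ∈ I <;> simp [rankOneX, rankOneY, xScalar, yScalar, h]
  x_pow := by
    refine LinearMap.ext fun f => funext fun l => ?_
    rw [rankOneX_pow_apply, rankOneY_pow_apply, prod_xScalar_eq I hI hk, Nat.cast_sub hk]
    simp [sub_eq_add_neg]

/-- `M` has profile `I | J`: there is a short exact sequence `0 → L_J → M → L_I → 0`. -/
def BAction.HasProfile {k : ℕ} {M : Type*} [AddCommGroup M] [Module ℂ⟦X⟧ M]
    (A : BAction k n M) (hk : k ≤ n) (I J : Finset (ZMod n)) (hI : I.card = k)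
    (hJ : J.card = k) : Prop :=
  ∃ (f : (ZMod n → ℂ⟦X⟧) →ₗ[ℂ⟦X⟧] M) (g : M →ₗ[ℂ⟦X⟧] (ZMod n → ℂ⟦X⟧)),
    BAction.IsHom (rankOne hk J hJ) A f ∧ BAction.IsHom A (rankOne hk I hI) g ∧
      Function.Injective f ∧ Function.Surjective g ∧ Function.Exact f g

end RankOne

/-! ## The poset of a module -/

section Poset

variable {n : ℕ}

/-- The cylindrical cover `Γ` of the circular quiver has vertices `(i, m) ∈ ℤ/n × ℤ`, lying over
the vertex `i`, with `m` the level. The arrow of `Γ` over `x_{i+1} : i → i + 1` starting at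
`(i, m)` ends here; the levels are normalised by letting `x_1, …, x_{n-1}` preserve the level. -/
def arrowX (k : ℕ) (p : ZMod n × ℤ) : ZMod n × ℤ :=
  (p.1 + 1, p.2 + if p.1 + 1 = 0 then (n : ℤ) - k else 0)

/-- The end point of the arrow of `Γ` over `y_i : i → i - 1` starting at `(i, m)`. It is
determined by the requirement that `xy` and `yx` (that is, `t`) raise the level by one. -/
def arrowY (k : ℕ) (p : ZMod n × ℤ) : ZMod n × ℤ :=
  (p.1 - 1, p.2 + if p.1 = 0 then 1 - ((n : ℤ) - k) else 1)

variable [NeZero n]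

/-- A finitely generated complete poset representation of `Γ` with total space `ℂ^d`: a subspace
at every vertex, all arrows being inclusions, zero far up and everything far down. -/
structure PosetRep (k n d : ℕ) [NeZero n] where
  W : ZMod n × ℤ → Submodule ℂ (Fin d → ℂ)
  le_x : ∀ p, W p ≤ W (arrowX k p)
  le_y : ∀ p, W p ≤ W (arrowY k p)
  eventually_bot : ∀ i, ∃ a : ℤ, ∀ m < a, W (i, m) = ⊥
  eventually_top : ∀ i, ∃ b : ℤ, ∀ m, b ≤ m → W (i, m) = ⊤

/-- The component at the vertex `(i, m)` of an element of `∏ i, ℂ^d((t))`. -/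
def coeffAt {d : ℕ} (f : ZMod n → Fin d → ℂ⸨X⸩) (p : ZMod n × ℤ) : Fin d → ℂ :=
  fun j => (f p.1 j).coeff p.2

/-- `M` is the image of the poset representation `R` under the covering functor: up to
isomorphism `e i M` consists of the formal series `∑ m, w_m t^m` with `w_m ∈ W (i, m)`, and the
arrows of the quiver act through the arrows of `Γ`. -/
def BAction.IsCoveredBy {k d : ℕ} {M : Type*} [AddCommGroup M] [Module ℂ⟦X⟧ M]
    (A : BAction k n M) (R : PosetRep k n d) : Prop :=
  ∃ F : M →ₗ[ℂ⟦X⟧] (ZMod n → Fin d → ℂ⸨X⸩),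
    Function.Injective F ∧
    (∀ f, (∃ v, F v = f) ↔ ∀ p, coeffAt f p ∈ R.W p) ∧
    (∀ i v p, coeffAt (F (A.e i v)) p = if p.1 = i then coeffAt (F v) p else 0) ∧
    (∀ v p, coeffAt (F (A.x v)) (arrowX k p) = coeffAt (F v) p) ∧
    (∀ v p, coeffAt (F (A.y v)) (arrowY k p) = coeffAt (F v) p)

/-- The full subgraph of `Γ` on the vertices whose subspace is a line. -/
def PosetRep.lineGraph {k d : ℕ} (R : PosetRep k n d) :
    SimpleGraph {p : ZMod n × ℤ // Module.finrank ℂ (R.W p) = 1} :=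
  SimpleGraph.fromRel fun p q => q.1 = arrowX k p.1 ∨ q.1 = arrowY k p.1

/-- The rank two module `M` has poset `(1^r, 2)`: it comes from a representation of `Γ` in
subspaces of `ℂ^2` for which contracting the connected parts of `Γ` with constant nonzero subspace
leaves `r` elements of dimension `1`. (The vertices of dimension `2` always form
a single element, which lies above all the others.) -/
def BAction.HasPosetOneTwo {k : ℕ} {M : Type*} [AddCommGroup M] [Module ℂ⟦X⟧ M]
    (A : BAction k n M) (r : ℕ) : Prop :=
  ∃ R : PosetRep k n 2, A.IsCoveredBy R ∧ Nat.card R.lineGraph.ConnectedComponent = r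

end Poset

/-! ## Roots of `J_{k,n}` -/

section Roots

/-- The tree `J_{k,n}` with nodes `1, …, n` viewed in `ℤ/n`: the path `1 - 2 - ⋯ - (n-1)`, and the
node `n = 0` joined to the node `k`. -/
def diagram (k n : ℕ) : SimpleGraph (ZMod n) :=
  SimpleGraph.fromRel fun i j =>
    (i ≠ 0 ∧ j ≠ 0 ∧ j = i + 1) ∨ (i = 0 ∧ j = (k : ZMod n))

open Classical in
/-- The generalised Cartan matrix of `J_{k,n}`. -/
noncomputable def cartanMatrix (k n : ℕ) : Matrix (ZMod n) (ZMod n) ℤ :=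
  Matrix.of fun i j => if i = j then 2 else if (diagram k n).Adj i j then -1 else 0

/-- The simple reflection `s_i` on the root lattice of `J_{k,n}`; a lattice element is given by its
coefficients at the simple roots. -/
noncomputable def simpleReflection (k : ℕ) {n : ℕ} [NeZero n] (i : ZMod n) (v : ZMod n → ℤ) :
    ZMod n → ℤ :=
  v - Pi.single i ((cartanMatrix k n).mulVec v i)

/-- The real roots of the Kac-Moody algebra of `J_{k,n}`: the images of the simple roots under the
Weyl group. -/
inductive IsRealRoot (k n : ℕ) [NeZero n] : (ZMod n → ℤ) → Prop
  | simple (i : ZMod n) : IsRealRoot k n (Pi.single i 1)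
  | reflect (i : ZMod n) (v : ZMod n → ℤ) :
      IsRealRoot k n v → IsRealRoot k n (simpleReflection k i v)

/-- The vector in `ℤ^n` corresponding to a simple root: `-e_i + e_{i+1}` for `α_i`
(`i = 1, …, n-1`) and `e_1 + ⋯ + e_k` for `β` (the node `n = 0`). -/
def simpleVector (k : ℕ) {n : ℕ} (i : ZMod n) : ZMod n → ℤ :=
  if i = 0 then ∑ j ∈ Finset.Icc 1 k, Pi.single (j : ZMod n) 1
  else Pi.single (i + 1) 1 - Pi.single i 1

/-- The embedding of the root lattice of `J_{k,n}` in `ℤ^n`. -/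
def latticeMap (k : ℕ) {n : ℕ} [NeZero n] (v : ZMod n → ℤ) : ZMod n → ℤ :=
  ∑ i, v i • simpleVector k i

/-- The quadratic form `q(a) = ∑ a_i^2 + (2-k)/k^2 (∑ a_i)^2`. -/
def quadForm (k : ℕ) {n : ℕ} [NeZero n] (a : ZMod n → ℤ) : ℚ :=
  ∑ i, (a i : ℚ) ^ 2 + (2 - (k : ℚ)) / (k : ℚ) ^ 2 * (∑ i, (a i : ℚ)) ^ 2

/-- The vector `a(M)` of a module with profile `I | J`: its entry at `i` is the multiplicity of
`i` in the multiset union of `I` and `J`. -/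
def multVector {n : ℕ} (I J : Finset (ZMod n)) (i : ZMod n) : ℤ :=
  (if i ∈ I then 1 else 0) + (if i ∈ J then 1 else 0)

/-- A module with profile `I | J` corresponds to a real root of `J_{k,n}`. -/
def CorrespondsToRealRoot (k : ℕ) {n : ℕ} [NeZero n] (I J : Finset (ZMod n)) : Prop :=
  ∃ v : ZMod n → ℤ, IsRealRoot k n v ∧ latticeMap k v = multVector I J

end Roots

end GrassmannianCM

/-! Numerics: since `I` and `J` have `k` elements, `q` of the multiplicity vector is `8 - 2k + 2|I ∩
J|`, which is part 2 (`quadForm_multVector`). The polar form of `q` has the Cartan matrix of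
`J_{k,n}` as its Gram matrix on the simple vectors (`bilinForm_simple`), so reflections preserve
`q`, real roots have `q = 2`, and `|I ∩ J| = k - 3`, that is `|I \ J| = |J \ I| = 3`.

Poset: after inverting `t` all vertex components become one plane `ℂ((t))^2`, and the module is a
cyclic family of lattices in it (`exists_triangularModel`). The submodule `L_J` singles out a line,
so the homothety class of the `i`-th lattice, a vertex of the Bruhat-Tits tree, is a ball `g_i + t ^
h_i ℂ⟦t⟧` with `h_i = b_i - a_i`. Going once round the cycle gives a closed walk in this tree,
moving to a smaller ball at `J \ I`, to a larger one at `I \ J`, and resting elsewhere.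

A closed walk with six moves spans a subtree with at most three edges, hence a path or a star
(`IsTreeWalk.star_or_path`). A path lies in an apartment: all lattices split along the same two
lines and the module decomposes (`TriangularModel.not_isIndecomposable_of_path`). In a star, a basis
of the central lattice makes every lattice homogeneous, so the module comes from a poset; a line
occurs exactly where the walk is off the centre, and the walk makes three excursions from the
centre, which gives the three components (`TriangularModel.hasPosetOneTwo_of_star`). -/

namespace GrassmannianCM

/-! ### The quadratic form, the Cartan matrix and real roots. -/

section Form

variable {k n : ℕ} [NeZero n]

theorem sum_multVector (I J : Finset (ZMod n)) :
    ∑ i, (multVector I J i : ℚ) = I.card + J.card := by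
  simp [multVector, Finset.sum_add_distrib]

theorem sum_sq_multVector (I J : Finset (ZMod n)) :
    ∑ i, (multVector I J i : ℚ) ^ 2 = I.card + J.card + 2 * (I ∩ J).card := by
  have : ∀ i, (multVector I J i : ℚ) ^ 2 = (if i ∈ I then 1 else 0) + (if i ∈ J then 1 else 0) +
      2 * (if i ∈ I ∩ J then 1 else 0) := by
    intro i
    by_cases h : i ∈ I <;> by_cases h' : i ∈ J <;> simp [multVector, h, h']
    norm_num
  simp only [this, Finset.sum_add_distrib, ← Finset.mul_sum, Finset.sum_boole,
    Finset.filter_univ_mem]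

/-- The squares sum to `2k + 2|I ∩ J|`; the entries sum to `2k`, so the correction term is `4(2 -
k)`. -/
theorem quadForm_multVector (hk : k ≠ 0) {I J : Finset (ZMod n)} (hI : I.card = k)
    (hJ : J.card = k) :
    quadForm k (multVector I J) = 8 - 2 * k + 2 * (I ∩ J).card := by
  rw [quadForm, sum_sq_multVector, sum_multVector, hI, hJ]
  have : (k : ℚ) ≠ 0 := by exact_mod_cast hk
  field_simp
  ring

/-- The symmetric bilinear form whose quadratic form is `quadForm`. -/
def bilinForm (k : ℕ) (a b : ZMod n → ℤ) : ℚ :=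
  ∑ i, (a i : ℚ) * b i + (2 - (k : ℚ)) / (k : ℚ) ^ 2 * ((∑ i, (a i : ℚ)) * ∑ i, (b i : ℚ))

theorem bilinForm_self (a : ZMod n → ℤ) : bilinForm k a a = quadForm k a := by
  simp [bilinForm, quadForm, sq]

theorem bilinForm_comm (a b : ZMod n → ℤ) : bilinForm k a b = bilinForm k b a := by
  simp [bilinForm, mul_comm]

theorem bilinForm_add_right (a b c : ZMod n → ℤ) :
    bilinForm k a (b + c) = bilinForm k a b + bilinForm k a c := by
  simp [bilinForm, mul_add, Finset.sum_add_distrib]; ring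

theorem bilinForm_smul_right (a b : ZMod n → ℤ) (c : ℤ) :
    bilinForm k a (c • b) = c * bilinForm k a b := by
  have h1 : ∑ i, (a i : ℚ) * ((c • b) i : ℤ) = c * ∑ i, (a i : ℚ) * b i := by
    rw [Finset.mul_sum]; exact Finset.sum_congr rfl fun i _ => by simp; ring
  have h2 : ∑ i, (((c • b) i : ℤ) : ℚ) = c * ∑ i, (b i : ℚ) := by
    rw [Finset.mul_sum]; exact Finset.sum_congr rfl fun i _ => by simp
  rw [bilinForm, h1, h2, bilinForm]; ring

theorem bilinForm_sum_right {ι : Type*} (a : ZMod n → ℤ) (s : Finset ι) (b : ι → ZMod n → ℤ) :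
    bilinForm k a (∑ i ∈ s, b i) = ∑ i ∈ s, bilinForm k a (b i) := by
  classical
  induction s using Finset.induction_on with
  | empty => simp [bilinForm]
  | insert i s hi ih => rw [Finset.sum_insert hi, bilinForm_add_right, ih, Finset.sum_insert hi]

omit [NeZero n] in
theorem natCast_injOn {a b : ℕ} (ha : a < n) (hb : b < n) (h : (a : ZMod n) = b) : a = b := by
  rw [ZMod.natCast_eq_natCast_iff'] at h
  rwa [Nat.mod_eq_of_lt ha, Nat.mod_eq_of_lt hb] at h

theorem simpleVector_zero_apply (hk : k < n) (i : ZMod n) :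
    simpleVector k (0 : ZMod n) i = if 1 ≤ i.val ∧ i.val ≤ k then 1 else 0 := by
  simp only [simpleVector, if_true, Finset.sum_apply, Pi.single_apply]
  by_cases h : 1 ≤ i.val ∧ i.val ≤ k
  · rw [Finset.sum_eq_single i.val]
    · simp [h]
    · intro b hb hne
      rw [if_neg]
      rintro rfl
      apply hne
      rw [ZMod.val_natCast, Nat.mod_eq_of_lt]
      have := Finset.mem_Icc.1 hb
      omega
    · intro h'; exact absurd (Finset.mem_Icc.2 h) h'
  · rw [if_neg h]
    refine Finset.sum_eq_zero fun j hj => if_neg ?_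
    rintro rfl
    have := Finset.mem_Icc.1 hj
    rw [ZMod.val_natCast, Nat.mod_eq_of_lt (by omega)] at h
    exact h this

theorem sum_simpleVector_zero : ∑ i, (simpleVector k (0 : ZMod n) i : ℚ) = k := by
  have : ∑ i, simpleVector k (0 : ZMod n) i = k := by
    simp only [simpleVector, if_true, Finset.sum_apply]
    rw [Finset.sum_comm]
    simp
  exact_mod_cast this

/-- The vector of `α_i` has coordinate sum `0`, so only the standard scalar product contributes. -/
theorem bilinForm_simple_right (a : ZMod n → ℤ) {i : ZMod n} (hi : i ≠ 0) :
    bilinForm k a (simpleVector k i) = a (i + 1) - a i := by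
  have h1 : ∑ l, (a l : ℚ) * (simpleVector k i l : ℤ) = a (i + 1) - a i := by
    simp [simpleVector, hi, Pi.single_apply, mul_sub, Finset.sum_sub_distrib]
  have h2 : ∑ l, ((simpleVector k i l : ℤ) : ℚ) = 0 := by
    simp [simpleVector, hi, Pi.single_apply, Finset.sum_sub_distrib]
  rw [bilinForm, h1, h2]; simp

/-- Here `k + (2 - k)/k² · k² = 2`: the coefficient in `q` is the one that gives `β` norm `2`. -/
theorem bilinForm_zero_zero (hk : 0 < k) (hkn : k < n) :
    bilinForm k (simpleVector k (0 : ZMod n)) (simpleVector k 0) = 2 := by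
  have h1 : ∑ l, (simpleVector k (0 : ZMod n) l : ℚ) * (simpleVector k (0 : ZMod n) l : ℤ) = k := by
    rw [← sum_simpleVector_zero (k := k) (n := n)]
    refine Finset.sum_congr rfl fun l _ => ?_
    rw [simpleVector_zero_apply hkn]
    split_ifs <;> simp
  rw [bilinForm, h1, sum_simpleVector_zero]
  have : (k : ℚ) ≠ 0 := by exact_mod_cast hk.ne'
  field_simp
  ring

theorem val_add_one' (hn : 1 < n) (i : ZMod n) :
    (i + 1).val = if i.val + 1 = n then 0 else i.val + 1 := by
  have hi := ZMod.val_lt i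
  rw [ZMod.val_add, ZMod.val_one'' (by omega)]
  split_ifs with h
  · rw [h, Nat.mod_self]
  · exact Nat.mod_eq_of_lt (by omega)

/-- Pairing with `α_i` is a difference of consecutive entries, and the indicator of `1, …, k` jumps
only from `0` to `1`, which `i ≠ 0` excludes, and from `k` to `k + 1`. -/
theorem bilinForm_zero_simple (hk : 0 < k) (hkn : k + 1 < n) {i : ZMod n} (hi : i ≠ 0) :
    bilinForm k (simpleVector k (0 : ZMod n)) (simpleVector k i) =
      if i = (k : ZMod n) then -1 else 0 := by
  rw [bilinForm_simple_right _ hi, simpleVector_zero_apply (by omega),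
    simpleVector_zero_apply (by omega), val_add_one' (by omega)]
  have h0 : i.val ≠ 0 := by simpa [ZMod.val_eq_zero] using hi
  have hv := ZMod.val_lt i
  have hik : i = (k : ZMod n) ↔ i.val = k := by
    constructor
    · rintro rfl; rw [ZMod.val_natCast, Nat.mod_eq_of_lt (by omega)]
    · intro h; rw [← h]; simp
  simp only [hik]
  split_ifs <;> first | omega | norm_num

omit [NeZero n] in
theorem one_ne_zero_zmod (hn : 1 < n) : (1 : ZMod n) ≠ 0 := by
  have : Fact (1 < n) := ⟨hn⟩
  exact one_ne_zero

omit [NeZero n] in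
theorem one_add_one_ne_zero (hn : 2 < n) : (1 + 1 : ZMod n) ≠ 0 := by
  intro h
  have := natCast_injOn (n := n) (a := 2) (b := 0) (by omega) (by omega) (by push_cast; rw [← h]; ring)
  omega

theorem bilinForm_simple (hk : 0 < k) (hkn : k + 1 < n) (hn : 2 < n) (i j : ZMod n) :
    bilinForm k (simpleVector k i) (simpleVector k j) = cartanMatrix k n i j := by
  have h1 := one_ne_zero_zmod (n := n) (by omega)
  have h2 := one_add_one_ne_zero (n := n) hn
  have hk0 : (k : ZMod n) ≠ 0 := by
    intro h
    have := natCast_injOn (n := n) (a := k) (b := 0) (by omega) (by omega) (by simpa using h)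
    omega
  have key : ∀ j : ZMod n, j ≠ 0 → bilinForm k (simpleVector k 0) (simpleVector k j) =
      cartanMatrix k n 0 j := by
    intro j hj
    rw [bilinForm_zero_simple hk hkn hj]
    by_cases h : j = k <;>
      simp [cartanMatrix, diagram, hj.symm, hj, h, hk0, hk0.symm]
  have symm : ∀ i j, cartanMatrix k n i j = cartanMatrix k n j i := by
    intro i j
    by_cases h : i = j
    · rw [h]
    · have h' : j ≠ i := fun h' => h h'.symm
      have hadj := (diagram k n).adj_comm i j
      by_cases a : (diagram k n).Adj i j
      · simp [cartanMatrix, h, h', a, hadj.1 a]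
      · simp [cartanMatrix, h, h', a, mt hadj.2 a]
  by_cases hi : i = 0
  · subst hi
    by_cases hj : j = 0
    · subst hj
      rw [bilinForm_zero_zero hk (by omega)]; simp [cartanMatrix]
    · exact key j hj
  · by_cases hj : j = 0
    · subst hj
      rw [bilinForm_comm, symm]; exact key i hi
    · rw [bilinForm_simple_right _ hj]
      simp only [simpleVector, hi, if_false, Pi.sub_apply, Pi.single_apply, cartanMatrix,
        Matrix.of_apply, diagram, SimpleGraph.fromRel_adj, hj, ne_eq, not_false_eq_true,
        true_and, false_and, or_false, add_left_inj]
      by_cases hij : i = j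
      · subst hij
        simp [h1]; norm_num
      · have a1 : j ≠ i := fun h => hij h.symm
        by_cases c1 : j = i + 1
        · subst c1
          -- As `n > 2`, the two neighbours of a vertex of the cycle differ, so the pairing picks up
          -- a single `-1`.
          have : i + 1 + 1 ≠ i := by
            intro h; apply h2; rw [add_assoc] at h; simpa using h
          simp [a1, h1, this]
        · by_cases c2 : i = j + 1
          · subst c2
            have : j ≠ j + 1 + 1 := by
              intro h; apply h2; rw [add_assoc] at h; simpa using h
            simp [h1, this]
          · have c2' : ¬ j + 1 = i := fun h => c2 h.symm
            simp [a1, hij, c1, c2, c2']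

/-- This identifies the coefficient in `simpleReflection` with a pairing, so that the reflection is
orthogonal for `bilinForm`. -/
theorem bilinForm_latticeMap (hk : 0 < k) (hkn : k + 1 < n) (hn : 2 < n) (i : ZMod n)
    (v : ZMod n → ℤ) :
    bilinForm k (simpleVector k i) (latticeMap k v) = (cartanMatrix k n).mulVec v i := by
  rw [latticeMap, bilinForm_sum_right]
  simp only [bilinForm_smul_right, bilinForm_simple hk hkn hn, Matrix.mulVec, dotProduct]
  push_cast
  exact Finset.sum_congr rfl fun j _ => mul_comm _ _

theorem latticeMap_single (i : ZMod n) (c : ℤ) :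
    latticeMap k (Pi.single i c) = c • simpleVector k i := by
  rw [latticeMap, Finset.sum_eq_single i]
  · simp
  · intro b _ hb; simp [hb]
  · simp

/-- Simple roots have norm `2`, and a reflection changes the norm by `-2c · c + 2c² = 0`, where `c`
is the pairing with the simple root. -/
theorem quadForm_of_isRealRoot (hk : 0 < k) (hkn : k + 1 < n) (hn : 2 < n) {v : ZMod n → ℤ}
    (hv : IsRealRoot k n v) : quadForm k (latticeMap k v) = 2 := by
  induction hv with
  | simple i =>
    rw [latticeMap_single, one_smul, ← bilinForm_self, bilinForm_simple hk hkn hn]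
    simp [cartanMatrix]
  | reflect i v _ ih =>
    set c := (cartanMatrix k n).mulVec v i with hc
    have h1 : latticeMap k (simpleReflection k i v) =
        latticeMap k v + (-c) • simpleVector k i := by
      rw [← latticeMap_single]
      rw [simpleReflection, ← hc, sub_eq_add_neg, ← Pi.single_neg]
      simp [latticeMap, add_smul, Finset.sum_add_distrib]
    have h2 := bilinForm_latticeMap hk hkn hn i v
    have h3 := bilinForm_simple hk hkn hn i i
    simp only [cartanMatrix, Matrix.of_apply, if_true] at h3
    rw [h1, ← bilinForm_self, bilinForm_add_right, bilinForm_smul_right,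
      bilinForm_comm _ (latticeMap k v), bilinForm_comm _ (simpleVector k i),
      bilinForm_add_right, bilinForm_add_right, bilinForm_smul_right, bilinForm_smul_right,
      bilinForm_comm (latticeMap k v) (simpleVector k i), h2, h3, bilinForm_self, ih, ← hc]
    push_cast
    ring

theorem card_inter_of_correspondsToRealRoot (hk : 0 < k) (hkn : k + 1 < n) (hn : 2 < n)
    {I J : Finset (ZMod n)} (hI : I.card = k) (hJ : J.card = k)
    (h : CorrespondsToRealRoot k I J) : (I ∩ J).card + 3 = k := by
  obtain ⟨v, hv, hvm⟩ := h
  have h1 := quadForm_of_isRealRoot hk hkn hn hv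
  rw [hvm, quadForm_multVector hk.ne' hI hJ] at h1
  have : ((I ∩ J).card : ℚ) + 3 = k := by linarith
  exact_mod_cast this

end Form

/-! ### Fractional ideals of the field of Laurent series. -/

section Laurent

/-- The monomial `t ^ m` in `ℂ((t))`. -/
noncomputable def tPow (m : ℤ) : ℂ⸨X⸩ := HahnSeries.single m 1

theorem tPow_zero : tPow 0 = 1 := rfl

theorem tPow_add (a b : ℤ) : tPow (a + b) = tPow a * tPow b := by
  simp [tPow, HahnSeries.single_mul_single]

theorem tPow_ne_zero (m : ℤ) : tPow m ≠ 0 := by simp [tPow]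

theorem tPow_mul_cancel {a b : ℤ} {x y : ℂ⸨X⸩} (h : tPow (a + b) * x = tPow a * y) :
    tPow b * x = y := by
  rw [tPow_add, mul_assoc] at h
  exact mul_left_cancel₀ (tPow_ne_zero a) h

theorem tPow_neg_mul (m : ℤ) : tPow (-m) * tPow m = 1 := by
  rw [← tPow_add, neg_add_cancel, tPow_zero]

theorem tPow_injective {a b : ℤ} (h : tPow a = tPow b) : a = b := by
  by_contra hne
  have := congrArg (fun x => HahnSeries.coeff x a) h
  simp [tPow, HahnSeries.coeff_single_of_ne hne] at this

theorem algebraMap_X : algebraMap ℂ⟦X⟧ ℂ⸨X⸩ PowerSeries.X = tPow 1 :=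
  HahnSeries.ofPowerSeries_X

theorem algebraMap_X_pow (m : ℕ) : algebraMap ℂ⟦X⟧ ℂ⸨X⸩ (PowerSeries.X ^ m) = tPow m :=
  HahnSeries.ofPowerSeries_X_pow m

theorem coeff_tPow_mul (a m : ℤ) (x : ℂ⸨X⸩) : (tPow a * x).coeff (m + a) = x.coeff m := by
  rw [tPow, HahnSeries.coeff_single_mul_add, one_mul]

theorem coeff_tPow_mul' (a m : ℤ) (x : ℂ⸨X⸩) : (tPow a * x).coeff m = x.coeff (m - a) := by
  rw [← coeff_tPow_mul a (m - a), sub_add_cancel]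

/-- The fractional ideal `t ^ m ℂ⟦t⟧` of `ℂ((t))`. -/
noncomputable def tIdeal (m : ℤ) : Submodule ℂ⟦X⟧ ℂ⸨X⸩ where
  carrier := {x | (m : WithTop ℤ) ≤ x.orderTop}
  zero_mem' := by simp
  add_mem' {a b} (ha : (m : WithTop ℤ) ≤ a.orderTop) (hb : (m : WithTop ℤ) ≤ b.orderTop) := by
    change (m : WithTop ℤ) ≤ (a + b).orderTop
    exact le_trans (le_min ha hb) HahnSeries.min_orderTop_le_orderTop_add
  smul_mem' r x hx := by
    have h0 : (0 : WithTop ℤ) ≤ (algebraMap ℂ⟦X⟧ ℂ⸨X⸩ r).orderTop := by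
      by_contra hlt
      rw [not_le, HahnSeries.orderTop_lt_iff_exists] at hlt
      obtain ⟨j, hj, hne⟩ := hlt
      have hj' : j < 0 := by exact_mod_cast hj
      apply hne
      have := PowerSeries.coeff_coe r j
      rw [if_pos hj'] at this
      exact this
    change (m : WithTop ℤ) ≤ _
    rw [Algebra.smul_def, HahnSeries.orderTop_mul]
    calc (m : WithTop ℤ) = 0 + m := (zero_add _).symm
      _ ≤ _ := add_le_add h0 hx

theorem mem_tIdeal_iff {m : ℤ} {x : ℂ⸨X⸩} : x ∈ tIdeal m ↔ ∀ j < m, x.coeff j = 0 := by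
  change (m : WithTop ℤ) ≤ _ ↔ _
  rw [← not_lt, HahnSeries.orderTop_lt_iff_exists]
  push Not
  exact forall_congr' fun j => by rw [WithTop.coe_lt_coe]

theorem tIdeal_anti {m m' : ℤ} (h : m ≤ m') {x : ℂ⸨X⸩} (hx : x ∈ tIdeal m') : x ∈ tIdeal m :=
  le_trans (WithTop.coe_le_coe.2 h) hx

theorem tPow_mem_tIdeal (m : ℤ) : tPow m ∈ tIdeal m :=
  mem_tIdeal_iff.2 fun _ hj => HahnSeries.coeff_single_of_ne hj.ne

theorem mul_mem_tIdeal {a b : ℤ} {x y : ℂ⸨X⸩} (hx : x ∈ tIdeal a) (hy : y ∈ tIdeal b) :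
    x * y ∈ tIdeal (a + b) := by
  change ((a + b : ℤ) : WithTop ℤ) ≤ _
  rw [HahnSeries.orderTop_mul, WithTop.coe_add]
  exact add_le_add hx hy

theorem mul_mem_tIdeal_of_eq {a b c : ℤ} {x y : ℂ⸨X⸩} (hx : x ∈ tIdeal a) (hy : y ∈ tIdeal b)
    (h : c = a + b) : x * y ∈ tIdeal c := h ▸ mul_mem_tIdeal hx hy

theorem tPow_mul_mem_tIdeal_iff {a m : ℤ} {x : ℂ⸨X⸩} :
    tPow a * x ∈ tIdeal m ↔ x ∈ tIdeal (m - a) := by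
  constructor
  · intro h
    have := mul_mem_tIdeal (tPow_mem_tIdeal (-a)) h
    rwa [← mul_assoc, tPow_neg_mul, one_mul, neg_add_eq_sub] at this
  · intro h
    exact mul_mem_tIdeal_of_eq (tPow_mem_tIdeal a) h (by ring)

theorem exists_of_mem_tIdeal {m : ℤ} {x : ℂ⸨X⸩} (hx : x ∈ tIdeal m) :
    ∃ r : ℂ⟦X⟧, algebraMap ℂ⟦X⟧ ℂ⸨X⸩ r * tPow m = x := by
  refine ⟨PowerSeries.mk fun j => x.coeff (j + m), ?_⟩
  rw [mul_comm]
  ext j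
  rw [coeff_tPow_mul']
  refine (PowerSeries.coeff_coe _ (j - m)).trans ?_
  split_ifs with h
  · exact (mem_tIdeal_iff.1 hx j (by omega)).symm
  · rw [PowerSeries.coeff_mk]
    congr 1
    omega

theorem algebraMap_mem_tIdeal (r : ℂ⟦X⟧) : algebraMap ℂ⟦X⟧ ℂ⸨X⸩ r ∈ tIdeal 0 := by
  have := (tIdeal 0).smul_mem r (tPow_mem_tIdeal 0)
  rwa [Algebra.smul_def, tPow_zero, mul_one] at this

theorem algebraMap_mul_tPow_mem (r : ℂ⟦X⟧) (m : ℤ) :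
    algebraMap ℂ⟦X⟧ ℂ⸨X⸩ r * tPow m ∈ tIdeal m :=
  mul_mem_tIdeal_of_eq (algebraMap_mem_tIdeal r) (tPow_mem_tIdeal m) (zero_add m).symm

/-- An element of `t ^ m ℂ⟦t⟧` outside `t ^ (m + 1) ℂ⟦t⟧` has its inverse in `t ^ (-m) ℂ⟦t⟧`. -/
theorem inv_mem_tIdeal {m : ℤ} {x : ℂ⸨X⸩} (hx : x ∉ tIdeal (m + 1)) :
    x⁻¹ ∈ tIdeal (-m) := by
  have hx0 : x ≠ 0 := fun h => hx (h ▸ zero_mem _)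
  have h1 : x.orderTop + x⁻¹.orderTop = 0 := by
    rw [← HahnSeries.orderTop_mul, mul_inv_cancel₀ hx0, HahnSeries.orderTop_one]
  change ¬ ((m + 1 : ℤ) : WithTop ℤ) ≤ _ at hx
  change ((-m : ℤ) : WithTop ℤ) ≤ _
  rw [HahnSeries.orderTop_of_ne_zero hx0] at h1 hx
  rw [HahnSeries.orderTop_of_ne_zero (inv_ne_zero hx0)] at h1 ⊢
  rw [WithTop.coe_le_coe] at hx ⊢
  have h2 : _ + _ = (0 : ℤ) := WithTop.coe_injective h1
  omega

end Laurent

/-! ### From a profile to a cyclic family of lattices in a plane. -/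

section Model

variable {k n : ℕ} [NeZero n] {M : Type*} [AddCommGroup M] [Module ℂ⟦X⟧ M]

/-- The rise of the level along the arrow of `Γ` over `y_i`. -/
def levelShift (k : ℕ) {n : ℕ} (i : ZMod n) : ℤ := if i = 0 then 1 - ((n : ℤ) - k) else 1

/-- The indicator function of `I`. -/
def indic {n : ℕ} (I : Finset (ZMod n)) (i : ZMod n) : ℤ := if i ∈ I then 1 else 0

/-- An embedding of a module with profile `I | J` in `∏ i, ℂ((t))^2`, with image the product of
the lattices spanned by `t ^ b_i (1, 0)` and `t ^ a_i (g_i, 1)`. -/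
structure TriangularModel (A : BAction k n M) (I J : Finset (ZMod n)) where
  F : M →ₗ[ℂ⟦X⟧] (ZMod n → Fin 2 → ℂ⸨X⸩)
  a : ZMod n → ℤ
  b : ZMod n → ℤ
  g : ZMod n → ℂ⸨X⸩
  injective : Function.Injective F
  mem_range : ∀ f, (∃ v, F v = f) ↔
    ∀ i, f i 1 ∈ tIdeal (a i) ∧ f i 0 - g i * f i 1 ∈ tIdeal (b i)
  map_e : ∀ i v j, F (A.e i v) j = if j = i then F v j else 0
  map_x : ∀ v i l, F (A.x v) i l = tPow (1 - levelShift k i) * F v (i - 1) l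
  map_y : ∀ v i l, F (A.y v) (i - 1) l = tPow (levelShift k i) * F v i l
  a_step : ∀ i, a i = a (i - 1) + indic I i - levelShift k i
  b_step : ∀ i, b i = b (i - 1) + indic J i - levelShift k i
  g_step : ∀ i, g i - g (i - 1) ∈ tIdeal (min (b i - a i) (b (i - 1) - a (i - 1)))

omit [NeZero n] in
theorem algebraMap_yScalar (I : Finset (ZMod n)) (i : ZMod n) :
    algebraMap ℂ⟦X⟧ ℂ⸨X⸩ (yScalar I i) = tPow (indic I i) := by
  unfold yScalar indic
  split_ifs
  · rw [algebraMap_X]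
  · rw [map_one]; rfl

omit [NeZero n] in
theorem yScalar_eq_X_pow (I : Finset (ZMod n)) (i : ZMod n) :
    ∃ N : ℕ, yScalar I i = PowerSeries.X ^ N := by
  unfold yScalar
  split_ifs
  · exact ⟨1, (pow_one _).symm⟩
  · exact ⟨0, (pow_zero _).symm⟩

omit [NeZero n] in
theorem rankOneX_single (I : Finset (ZMod n)) (i : ZMod n) :
    rankOneX I (Pi.single (i - 1) 1) = xScalar I i • Pi.single i 1 := by
  ext1 l
  by_cases h : l = i
  · subst h; simp [rankOneX]
  · simp [rankOneX, h]

omit [NeZero n] in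
theorem rankOneY_single (I : Finset (ZMod n)) (i : ZMod n) :
    rankOneY I (Pi.single i 1) = yScalar I i • Pi.single (i - 1) 1 := by
  ext1 l
  by_cases h : l = i - 1
  · subst h; simp [rankOneY]
  · have h' : l + 1 ≠ i := fun h' => h (eq_sub_of_add_eq h')
    simp [rankOneY, h, h']

omit [NeZero n] in
theorem rankOneE_single (i j : ZMod n) :
    rankOneE j (Pi.single i 1) = if j = i then Pi.single i 1 else 0 := by
  ext1 l
  by_cases h : l = j
  · subst h
    by_cases h' : l = i <;> simp [rankOneE, h']
  · by_cases h' : j = i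
    · subst h'; simp [rankOneE, h]
    · simp [rankOneE, h, h']

namespace BAction

variable (A : BAction k n M)

theorem x_apply_e (i : ZMod n) (v : M) : A.x (A.e i v) = A.e (i + 1) (A.x v) :=
  LinearMap.congr_fun (A.x_mul_e i) v

theorem y_apply_e (i : ZMod n) (v : M) : A.y (A.e i v) = A.e (i - 1) (A.y v) :=
  LinearMap.congr_fun (A.y_mul_e i) v

theorem y_apply_x (v : M) : A.y (A.x v) = (PowerSeries.X : ℂ⟦X⟧) • v :=
  LinearMap.congr_fun A.y_mul_x v

theorem e_apply_e (i j : ZMod n) (v : M) : A.e i (A.e j v) = if i = j then A.e i v else 0 := by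
  have := LinearMap.congr_fun (A.e_mul_e i j) v
  split_ifs with h
  · rw [if_pos h] at this; exact this
  · rw [if_neg h] at this; exact this

theorem y_pow_apply_e (m : ℕ) (i : ZMod n) (v : M) :
    (A.y ^ m) (A.e i v) = A.e (i - m) ((A.y ^ m) v) := by
  induction m with
  | zero => simp
  | succ m ih =>
    rw [pow_succ', Module.End.mul_apply, ih, y_apply_e, Module.End.mul_apply]
    congr 2
    push_cast; ring

/-- Since `y^(n-k) = x^k`, one turn is `x^k y^k = (xy)^k`. This monodromy is the source of the
exceptional value of `levelShift` at `0`. -/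
theorem y_pow_n (hk : k ≤ n) : A.y ^ n = (PowerSeries.X : ℂ⟦X⟧) ^ k • (1 : Module.End ℂ⟦X⟧ M) := by
  have hc : Commute A.x A.y := A.x_mul_y.trans A.y_mul_x.symm
  calc A.y ^ n = A.y ^ (n - k) * A.y ^ k := by rw [← pow_add, Nat.sub_add_cancel hk]
    _ = (A.x * A.y) ^ k := by rw [← A.x_pow, hc.mul_pow]
    _ = _ := by rw [A.x_mul_y, smul_pow, one_pow]

end BAction

/-- A module with profile `I | J` has a triangular model. -/
theorem exists_triangularModel (A : BAction k n M) (hk : k ≤ n) {I J : Finset (ZMod n)}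
    {hI : I.card = k} {hJ : J.card = k} (h : A.HasProfile hk I J hI hJ) :
    Nonempty (TriangularModel A I J) := by
  obtain ⟨f, G, ⟨fe, -, fy⟩, ⟨Ge, Gx, Gy⟩, finj, Gsurj, hex⟩ := h
  let ι := algebraMap ℂ⟦X⟧ ℂ⸨X⸩
  let u : ZMod n → M := fun i => f (Pi.single i 1)
  choose m hm using fun i : ZMod n => Gsurj (Pi.single i 1)
  -- Applying `e i` to an arbitrary lift places it at the vertex `i`; the image in `L_I` is
  -- unaffected.
  let w : ZMod n → M := fun i => A.e i (m i)
  have ew : ∀ j i, A.e j (w i) = if j = i then w i else 0 := by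
    intro j i
    refine (A.e_apply_e j i (m i)).trans ?_
    split_ifs with h
    · rw [h]
    · rfl
  have Gw : ∀ i, G (w i) = Pi.single i 1 := by
    intro i
    refine (Ge i _).trans ?_
    rw [hm]
    change rankOneE i (Pi.single i 1) = _
    rw [rankOneE_single, if_pos rfl]
  have Gu : ∀ φ, G (f φ) = 0 := fun φ => hex.apply_apply_eq_zero φ
  have yu : ∀ i, A.y (u i) = yScalar J i • u (i - 1) := by
    intro i
    refine (fy _).symm.trans ?_
    change f (rankOneY J (Pi.single i 1)) = _
    rw [rankOneY_single, map_smul]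
  have fu : ∀ i φ, A.e i (f φ) = φ i • u i := by
    intro i φ
    refine (fe i _).symm.trans ?_
    change f (rankOneE i φ) = _
    rw [← map_smul]
    congr 1
    ext1 l
    by_cases h : l = i
    · subst h; simp [rankOneE]
    · simp [rankOneE, h]
  have expand : ∀ i v, A.e i v = v → ∃ c : ℂ⟦X⟧, v = G v i • w i + c • u i := by
    intro i v hv
    have hG : G v = G v i • Pi.single i 1 := by
      have h1 := Ge i v
      rw [hv] at h1
      refine h1.trans ?_
      change rankOneE i (G v) = _
      ext1 l
      by_cases h : l = i
      · subst h; simp [rankOneE]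
      · simp [rankOneE, h]
    obtain ⟨φ, hφ⟩ := (hex (v - G v i • w i)).1 (by rw [map_sub, map_smul, Gw, ← hG, sub_self])
    refine ⟨φ i, ?_⟩
    rw [← fu, hφ, map_sub, map_smul, hv, ew, if_pos rfl]
    abel
  have xw : ∀ i, ∃ c : ℂ⟦X⟧, A.x (w (i - 1)) = xScalar I i • w i + c • u i := by
    intro i
    have h1 : A.e i (A.x (w (i - 1))) = A.x (w (i - 1)) := by
      have := A.x_apply_e (i - 1) (w (i - 1))
      rw [sub_add_cancel, ew, if_pos rfl] at this
      exact this.symm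
    obtain ⟨c, hc⟩ := expand i _ h1
    refine ⟨c, hc.trans ?_⟩
    congr 2
    rw [Gx, Gw]
    change rankOneX I _ i = _
    rw [rankOneX_single]
    simp
  have yw : ∀ i, ∃ d : ℂ⟦X⟧, A.y (w i) = yScalar I i • w (i - 1) + d • u (i - 1) := by
    intro i
    have h1 : A.e (i - 1) (A.y (w i)) = A.y (w i) := by
      have := A.y_apply_e i (w i)
      rw [ew, if_pos rfl] at this
      exact this.symm
    obtain ⟨c, hc⟩ := expand (i - 1) _ h1
    refine ⟨c, hc.trans ?_⟩
    congr 2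
    rw [Gy, Gw]
    change rankOneY I _ _ = _
    rw [rankOneY_single]
    simp
  -- The extension splits over the centre because `L_I` is free: the `u i` and `w i` together form a
  -- basis of the module.
  let Φ : ((ZMod n → ℂ⟦X⟧) × (ZMod n → ℂ⟦X⟧)) →ₗ[ℂ⟦X⟧] M :=
    f.coprod (Fintype.linearCombination ℂ⟦X⟧ w)
  have Φ_apply : ∀ p, Φ p = f p.1 + ∑ i, p.2 i • w i := fun p => rfl
  have GΦ : ∀ p, G (Φ p) = p.2 := by
    intro p
    rw [Φ_apply, map_add, Gu, map_sum, zero_add]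
    simp only [map_smul, Gw]
    ext1 l
    simp [Finset.sum_apply, Pi.single_apply]
  have Φbij : Function.Bijective Φ := by
    constructor
    · rw [← LinearMap.ker_eq_bot, LinearMap.ker_eq_bot']
      intro p hp
      have h2 : p.2 = 0 := by rw [← GΦ, hp, map_zero]
      have h1 : p.1 = 0 := by
        apply finj
        rw [map_zero, ← hp, Φ_apply, h2]
        simp
      exact Prod.ext h1 h2
    · intro v
      obtain ⟨φ, hφ⟩ := (hex (v - ∑ i, G v i • w i)).1 (by
        have := GΦ (0, G v)
        rw [Φ_apply, map_add, map_zero, map_zero, zero_add] at this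
        rw [map_sub, this, sub_self])
      refine ⟨(φ, G v), ?_⟩
      rw [Φ_apply, hφ, sub_add_cancel]
  let D := (LinearEquiv.ofBijective Φ Φbij).symm
  have DΦ : ∀ p, D (Φ p) = p := fun p => (LinearEquiv.ofBijective Φ Φbij).symm_apply_apply p
  have ΦD : ∀ v, Φ (D v) = v := fun v => (LinearEquiv.ofBijective Φ Φbij).apply_symm_apply v
  have eΦ : ∀ i p, A.e i (Φ p) = p.1 i • u i + p.2 i • w i := by
    intro i p
    rw [Φ_apply, map_add, fu, map_sum]
    simp only [map_smul, ew]
    simp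
  have Du : ∀ i (c : ℂ⟦X⟧), D (c • u i) = (Pi.single i c, 0) := by
    intro i c
    rw [← DΦ (Pi.single i c, 0), Φ_apply]
    congr 1
    simp only [Pi.zero_apply, zero_smul, Finset.sum_const_zero, add_zero]
    rw [← map_smul]
    congr 1
    ext1 l
    by_cases h : l = i
    · subst h; simp
    · simp [h]
  have Dw : ∀ i (c : ℂ⟦X⟧), D (c • w i) = (0, Pi.single i c) := by
    intro i c
    rw [← DΦ (0, Pi.single i c), Φ_apply]
    congr 1
    simp [Pi.single_apply, ite_smul]
  have De : ∀ i v j, (D (A.e i v)).1 j = (if j = i then (D v).1 j else 0) ∧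
      (D (A.e i v)).2 j = (if j = i then (D v).2 j else 0) := by
    intro i v j
    have := eΦ i (D v)
    rw [ΦD] at this
    rw [this, map_add, Du, Dw]
    by_cases h : j = i
    · subst h; simp
    · simp [h]
  let P : Fin 2 → ((ZMod n → ℂ⟦X⟧) × (ZMod n → ℂ⟦X⟧)) →ₗ[ℂ⟦X⟧] ℂ⟦X⟧ :=
    ![LinearMap.proj 0 ∘ₗ LinearMap.fst _ _ _, LinearMap.proj 0 ∘ₗ LinearMap.snd _ _ _]
  -- The component at the vertex `i` is carried to the vertex `0` by `y^i` and read in the basis `u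
  -- 0, w 0`. The factor `t^(-i)` makes `x_1, …, x_{n-1}` act as the identity, as in the levels of
  -- `Γ`.
  let F : M →ₗ[ℂ⟦X⟧] (ZMod n → Fin 2 → ℂ⸨X⸩) :=
    LinearMap.pi fun i => LinearMap.pi fun l =>
      LinearMap.mulLeft ℂ⟦X⟧ (tPow (-(i.val : ℤ))) ∘ₗ Algebra.linearMap ℂ⟦X⟧ ℂ⸨X⸩ ∘ₗ
        P l ∘ₗ D.toLinearMap ∘ₗ (A.y ^ i.val)
  have F_apply : ∀ v i l, F v i l = tPow (-(i.val : ℤ)) * ι (P l (D ((A.y ^ i.val) v))) :=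
    fun v i l => rfl
  have Pe : ∀ l i v, P l (D (A.e i v)) = if i = 0 then P l (D v) else 0 := by
    intro l i v
    have h := De i v 0
    simp only [eq_comm (a := (0 : ZMod n))] at h
    fin_cases l
    · exact h.1
    · exact h.2
  have Fe : ∀ i v j, F (A.e i v) j = if j = i then F v j else 0 := by
    intro i v j
    ext1 l
    rw [F_apply, A.y_pow_apply_e, Pe, ZMod.natCast_zmod_val j]
    by_cases h : j = i
    · subst h; simp [F_apply]
    · have h' : i - j ≠ 0 := fun h' => h (sub_eq_zero.1 h').symm
      simp [h, h']
  have Fy : ∀ v i l, F (A.y v) (i - 1) l = tPow (levelShift k i) * F v i l := by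
    intro v i l
    rw [F_apply, F_apply, ← mul_assoc, ← tPow_add, ← Module.End.mul_apply, ← pow_succ]
    by_cases h : i = 0
    · subst h
      -- The arrow from `0` to `n - 1` closes the circle: `y^n = t^k` and the factor `t^(-(n-1))`
      -- combine to `t^(1-(n-k))`.
      have hv : ((0 - 1 : ZMod n)).val + 1 = n := by
        have hn : n - 1 + 1 = n := Nat.sub_add_cancel (NeZero.pos n)
        rw [zero_sub]
        obtain ⟨r, rfl⟩ : ∃ r, n = r + 1 := ⟨n - 1, hn.symm⟩
        rw [ZMod.val_neg_one]
      have hv' : (((0 - 1 : ZMod n)).val : ℤ) = n - 1 := by omega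
      rw [hv, hv', A.y_pow_n hk]
      simp only [LinearMap.smul_apply, Module.End.one_apply, map_smul, smul_eq_mul, map_mul,
        ZMod.val_zero, pow_zero, levelShift, if_true, ι, algebraMap_X_pow]
      rw [← mul_assoc, ← tPow_add]
      congr 2
      push_cast; ring
    · have hv : (i - 1).val + 1 = i.val := by
        have h0 : i.val ≠ 0 := by simpa [ZMod.val_eq_zero] using h
        have hlt := ZMod.val_lt i
        have := val_add_one' (n := n) (by omega) (i - 1)
        rw [sub_add_cancel] at this
        split_ifs at this
        · omega
        · exact this.symm
      rw [hv]
      congr 2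
      rw [levelShift, if_neg h]
      omega
  have Fsmul : ∀ (c : ℂ⟦X⟧) v i l, F (c • v) i l = ι c * F v i l := by
    intro c v i l
    rw [map_smul, Pi.smul_apply, Pi.smul_apply, Algebra.smul_def]
  have Fx : ∀ v i l, F (A.x v) i l = tPow (1 - levelShift k i) * F v (i - 1) l := by
    intro v i l
    -- The action of `x` follows from that of `y` and `yx = t`.
    have h1 := Fy (A.x v) i l
    rw [A.y_apply_x, Fsmul] at h1
    have h2 : ι PowerSeries.X = tPow (levelShift k i + (1 - levelShift k i)) := by
      rw [add_sub_cancel]; exact algebraMap_X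
    rw [h2] at h1
    exact (tPow_mul_cancel h1).symm
  -- Transport by `y` is triangular in the bases `u, w`, with powers of `t` on the diagonal; hence
  -- the exponents `b_i` and `a_i`, and `g_i` from the off-diagonal entry.
  have yu_pow : ∀ (m : ℕ) i, ∃ N : ℕ, (A.y ^ m) (u i) = (PowerSeries.X : ℂ⟦X⟧) ^ N • u (i - m) := by
    intro m i
    induction m with
    | zero => exact ⟨0, by simp⟩
    | succ m ih =>
      obtain ⟨N, hN⟩ := ih
      obtain ⟨N', hN'⟩ := yScalar_eq_X_pow J (i - m)
      refine ⟨N + N', ?_⟩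
      rw [pow_succ', Module.End.mul_apply, hN, map_smul, yu, hN', smul_smul, ← pow_add]
      congr 2
      push_cast; ring
  have yw_pow : ∀ (m : ℕ) i, ∃ (N : ℕ) (c : ℂ⟦X⟧), (A.y ^ m) (w i) =
      (PowerSeries.X : ℂ⟦X⟧) ^ N • w (i - m) + c • u (i - m) := by
    intro m i
    induction m with
    | zero => exact ⟨0, 0, by simp⟩
    | succ m ih =>
      obtain ⟨N, c, hN⟩ := ih
      obtain ⟨N', hN'⟩ := yScalar_eq_X_pow I (i - m)
      obtain ⟨d, hd⟩ := yw (i - m)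
      refine ⟨N + N', PowerSeries.X ^ N * d + c * yScalar J (i - m), ?_⟩
      have hi : i - ((m + 1 : ℕ) : ZMod n) = i - m - 1 := by push_cast; ring
      rw [pow_succ', Module.End.mul_apply, hN, map_add, map_smul, map_smul, yu, hd, hN', hi,
        pow_add, add_smul, mul_smul, mul_smul, mul_smul, smul_add]
      abel
  have sub_val : ∀ i : ZMod n, i - (i.val : ZMod n) = 0 := by
    intro i; rw [ZMod.natCast_val, ZMod.cast_id, sub_self]
  have Fu : ∀ i, ∃ b : ℤ, F (u i) i 0 = tPow b ∧ F (u i) i 1 = 0 := by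
    intro i
    obtain ⟨N, hN⟩ := yu_pow i.val i
    rw [sub_val] at hN
    refine ⟨-(i.val : ℤ) + N, ?_, ?_⟩
    · rw [F_apply, hN, Du, tPow_add, ← algebraMap_X_pow]
      simp [P, ι]
    · rw [F_apply, hN, Du]
      simp [P]
  have Fw : ∀ i, ∃ a : ℤ, F (w i) i 1 = tPow a := by
    intro i
    obtain ⟨N, c, hN⟩ := yw_pow i.val i
    rw [sub_val] at hN
    refine ⟨-(i.val : ℤ) + N, ?_⟩
    rw [F_apply, hN, map_add, Du, Dw, tPow_add, ← algebraMap_X_pow]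
    simp [P, ι]
  choose b hb0 hb1 using Fu
  choose a ha using Fw
  have Fv : ∀ v i l, F v i l = ι ((D v).1 i) * F (u i) i l + ι ((D v).2 i) * F (w i) i l := by
    intro v i l
    have h1 := congrFun (Fe i v i) l
    have h2 := eΦ i (D v)
    rw [ΦD] at h2
    rw [if_pos rfl, h2, map_add, Pi.add_apply, Pi.add_apply, Fsmul, Fsmul] at h1
    exact h1.symm
  have a_step : ∀ i, a i = a (i - 1) + indic I i - levelShift k i := by
    intro i
    obtain ⟨d, hd⟩ := yw i
    have h1 := Fy (w i) i 1
    rw [hd, map_add, Pi.add_apply, Pi.add_apply, Fsmul, Fsmul, hb1, mul_zero, add_zero, ha, ha,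
      algebraMap_yScalar, ← tPow_add, ← tPow_add] at h1
    have := tPow_injective h1
    omega
  have b_step : ∀ i, b i = b (i - 1) + indic J i - levelShift k i := by
    intro i
    have h1 := Fy (u i) i 0
    rw [yu, Fsmul, hb0, hb0, algebraMap_yScalar, ← tPow_add, ← tPow_add] at h1
    have := tPow_injective h1
    omega
  have hι : ∀ r, r ≠ 0 → ι r ≠ 0 := fun r hr => by
    rw [Ne, FaithfulSMul.algebraMap_eq_zero_iff]
    exact hr
  obtain ⟨g, hg⟩ : ∃ g : ZMod n → ℂ⸨X⸩, ∀ i, F (w i) i 0 = tPow (a i) * g i := by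
    refine ⟨fun i => tPow (-a i) * F (w i) i 0, fun i => ?_⟩
    rw [← mul_assoc, ← tPow_add, add_neg_cancel, tPow_zero, one_mul]
  refine ⟨⟨F, a, b, g, ?_, ?_, Fe, Fx, Fy, a_step, b_step, ?_⟩⟩
  · rw [← LinearMap.ker_eq_bot, LinearMap.ker_eq_bot']
    intro v hv
    have h2 : (D v).2 = 0 := by
      ext1 i
      have := Fv v i 1
      rw [hv, hb1, mul_zero, zero_add, ha] at this
      by_contra h
      exact mul_ne_zero (hι _ h) (tPow_ne_zero _) this.symm
    have h1 : (D v).1 = 0 := by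
      ext1 i
      have := Fv v i 0
      have h2i : (D v).2 i = 0 := congrFun h2 i
      rw [hv, h2i, hb0, map_zero, zero_mul, add_zero] at this
      by_contra h
      exact mul_ne_zero (hι _ h) (tPow_ne_zero _) this.symm
    have h3 : D v = 0 := Prod.ext h1 h2
    rw [← ΦD v, h3, map_zero]
  · intro φ
    constructor
    · rintro ⟨v, rfl⟩ i
      rw [Fv v i 1, Fv v i 0, hb1, hb0, ha, hg]
      constructor
      · rw [mul_zero, zero_add]
        exact algebraMap_mul_tPow_mem _ _
      · have : ∀ p q r s : ℂ⸨X⸩, p * q + r * (tPow (a i) * s) - s * (p * 0 + r * tPow (a i)) =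
          p * q := by intros; ring
        rw [this]
        exact algebraMap_mul_tPow_mem _ _
    · intro hφ
      choose β hβ using fun i => exists_of_mem_tIdeal (hφ i).1
      choose α hα using fun i => exists_of_mem_tIdeal (hφ i).2
      refine ⟨Φ (α, β), ?_⟩
      ext1 i
      ext1 l
      have h1 : F (Φ (α, β)) i 1 = φ i 1 := by
        rw [Fv, DΦ, hb1, ha, mul_zero, zero_add]
        exact hβ i
      have h0 : F (Φ (α, β)) i 0 = φ i 0 := by
        rw [Fv, DΦ, hb0, hg]
        have h2 := hα i
        rw [← hβ i] at h2
        change ι (α i) * _ = _ at h2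
        rw [h2]
        change _ - _ * (ι (β i) * _) + ι (β i) * _ = _
        ring
      fin_cases l
      · exact h0
      · exact h1
  · intro i
    -- For `i ∈ I` the arrow `x_i` sends `w (i - 1)` to `w i` modulo `u i`, which bounds `g i - g (i
    -- - 1)` by the height at `i`; otherwise `y_i` sends `w i` to `w (i - 1)` modulo `u (i - 1)`,
    -- and the height at `i - 1` bounds it.
    by_cases hi : i ∈ I
    · obtain ⟨c, hc⟩ := xw i
      have h1 := Fx (w (i - 1)) i 0
      have e1 : a i = a (i - 1) + (1 - levelShift k i) := by
        rw [a_step, indic, if_pos hi]; ring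
      rw [hc, map_add, Pi.add_apply, Pi.add_apply, Fsmul, Fsmul, hb0, hg, hg, xScalar, if_pos hi,
        map_one, one_mul, ← mul_assoc, ← tPow_add,
        show 1 - levelShift k i + a (i - 1) = a i by rw [e1]; ring] at h1
      have h2 : tPow (a i) * (g i - g (i - 1)) = -(ι c * tPow (b i)) := by
        rw [mul_sub, ← h1]; ring
      have h3 : tPow (a i) * (g i - g (i - 1)) ∈ tIdeal (b i) := by
        rw [h2]; exact neg_mem (algebraMap_mul_tPow_mem _ _)
      exact tIdeal_anti (min_le_left _ _) (tPow_mul_mem_tIdeal_iff.1 h3)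
    · obtain ⟨c, hc⟩ := yw i
      have h1 := Fy (w i) i 0
      have e1 : levelShift k i + a i = a (i - 1) := by
        rw [a_step i, indic, if_neg hi]; ring
      rw [hc, map_add, Pi.add_apply, Pi.add_apply, Fsmul, Fsmul, hb0, hg, hg, yScalar, if_neg hi,
        map_one, one_mul, ← mul_assoc, ← tPow_add, e1] at h1
      have h2 : tPow (a (i - 1)) * (g i - g (i - 1)) = ι c * tPow (b (i - 1)) := by
        rw [mul_sub, ← h1]; ring
      have h3 : tPow (a (i - 1)) * (g i - g (i - 1)) ∈ tIdeal (b (i - 1)) := by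
        rw [h2]; exact algebraMap_mul_tPow_mem _ _
      exact tIdeal_anti (min_le_right _ _) (tPow_mul_mem_tIdeal_iff.1 h3)

end Model

/-! ### Arcs of the cycle `ℤ/n`. -/

section Cyclic

variable {n : ℕ} [NeZero n]

/-- Induction along the maximal arcs of a proper subset of the cycle `ℤ/n`. -/
theorem arc_induction {S P : ZMod n → Prop} (hS : ∃ j, ¬ S j)
    (start : ∀ i, S i → ¬ S (i - 1) → P i) (step : ∀ i, S i → S (i - 1) → P (i - 1) → P i)
    (i : ZMod n) (hi : S i) : P i := by
  obtain ⟨j, hj⟩ := hS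
  -- Starting outside `S` and going round forwards, every arc is met at its first element.
  have key : ∀ d : ℕ, S (j + d) → P (j + d) := by
    intro d
    induction d with
    | zero => intro h; simp [hj] at h
    | succ d ih =>
      intro h
      have e : j + ((d + 1 : ℕ) : ZMod n) - 1 = j + d := by push_cast; ring
      by_cases h' : S (j + d)
      · exact step _ h (by rwa [e]) (by rw [e]; exact ih h')
      · exact start _ h (by rwa [e])
  have e : j + ((i - j).val : ZMod n) = i := by rw [ZMod.natCast_zmod_val]; ring
  rw [← e]
  exact key _ (by rwa [e])

/-- Every maximal arc of a proper subset of the cycle `ℤ/n` has a first element. -/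
theorem exists_arcStart {S : ZMod n → Prop} (hS : ∃ j, ¬ S j) :
    ∃ st : ZMod n → ZMod n, (∀ i, S i → ¬ S (i - 1) → st i = i) ∧
      ∀ i, S i → S (i - 1) → st i = st (i - 1) := by
  classical
  have hex : ∀ i : ZMod n, ∃ d : ℕ, ¬ S (i - d) := by
    intro i
    obtain ⟨j, hj⟩ := hS
    refine ⟨(i - j).val, ?_⟩
    rw [ZMod.natCast_zmod_val]
    simpa using hj
  -- The arc of `i` begins just after the nearest preceding element outside `S`.
  refine ⟨fun i => i - Nat.find (hex i) + 1, fun i hi hi' => ?_, fun i hi hi' => ?_⟩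
  · have : Nat.find (hex i) = 1 := by
      rw [Nat.find_eq_iff]
      refine ⟨by simpa using hi', fun m hm => ?_⟩
      obtain rfl : m = 0 := by omega
      simpa using hi
    simp [this]
  · have : Nat.find (hex i) = Nat.find (hex (i - 1)) + 1 := by
      rw [Nat.find_eq_iff]
      have e : ∀ d : ℕ, i - ((d + 1 : ℕ) : ZMod n) = i - 1 - d := by intro d; push_cast; ring
      refine ⟨?_, fun m hm => ?_⟩
      · rw [e]; exact Nat.find_spec (hex (i - 1))
      · cases m with
        | zero => simpa using hi
        | succ m =>
          rw [e]
          exact Nat.find_min (hex (i - 1)) (by omega)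
    simp only [this]
    push_cast
    ring

/-- A subset of the cycle `ℤ/n` is entered as often as it is left. -/
theorem card_enter_eq_card_leave (S : ZMod n → Prop) [DecidablePred S] :
    (Finset.univ.filter fun i => S i ∧ ¬ S (i - 1)).card =
      (Finset.univ.filter fun i => ¬ S i ∧ S (i - 1)).card := by
  have h1 := Finset.card_filter_add_card_filter_not (s := Finset.univ.filter fun i => S i)
    (fun i => S (i - 1))
  have h2 := Finset.card_filter_add_card_filter_not (s := Finset.univ.filter fun i => S (i - 1))
    (fun i => S i)
  have h3 : (Finset.univ.filter fun i => S (i - 1)).card =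
      (Finset.univ.filter fun i => S i).card := by
    refine Finset.card_bij (fun i _ => i - 1) ?_ ?_ ?_
    · intro i hi; simpa using hi
    · intro i _ j _ h; exact sub_left_injective h
    · intro i hi; exact ⟨i + 1, by simpa using hi, by simp⟩
  simp only [Finset.filter_filter] at h1 h2
  have h4 : (Finset.univ.filter fun i => S (i - 1) ∧ S i) =
      Finset.univ.filter fun i => S i ∧ S (i - 1) := by
    ext i; simp [and_comm]
  have h5 : (Finset.univ.filter fun i => S (i - 1) ∧ ¬ S i) =
      Finset.univ.filter fun i => ¬ S i ∧ S (i - 1) := by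
    ext i; simp [and_comm]
  rw [h4, h5] at h2
  omega

end Cyclic

/-! ### Closed walks in the tree of balls. -/

section Walk

variable {n : ℕ} [NeZero n]

/-- A closed walk of period `n` in the tree of balls `g_i + t ^ h_i ℂ⟦t⟧` of `ℂ((t))`, which moves
to a smaller ball at the elements of `J \ I` and to a larger one at the elements of `I \ J`. -/
structure IsTreeWalk (I J : Finset (ZMod n)) (h : ZMod n → ℤ) (g : ZMod n → ℂ⸨X⸩) : Prop where
  h_step : ∀ i, h i = h (i - 1) + indic J i - indic I i
  g_step : ∀ i, g i - g (i - 1) ∈ tIdeal (min (h i) (h (i - 1)))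

omit [NeZero n] in
theorem indic_sub_indic_cases (I J : Finset (ZMod n)) (i : ZMod n) :
    (i ∈ J \ I ∧ indic J i - indic I i = 1) ∨ (i ∈ I \ J ∧ indic J i - indic I i = -1) ∨
      (i ∉ J \ I ∧ i ∉ I \ J ∧ indic J i - indic I i = 0) := by
  by_cases h : i ∈ I <;> by_cases h' : i ∈ J <;> simp [indic, h, h']

/-- The steps of the walk that enter the set of balls of height more than `l`. -/
def upSteps (I J : Finset (ZMod n)) (h : ZMod n → ℤ) (l : ℤ) : Finset (ZMod n) :=
  (J \ I).filter fun i => h (i - 1) = l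

namespace IsTreeWalk

variable {I J : Finset (ZMod n)} {h : ZMod n → ℤ} {g : ZMod n → ℂ⸨X⸩}

omit [NeZero n] in
theorem sub_mem_of_le (H : IsTreeWalk I J h g) {i : ZMod n} {l : ℤ} (h1 : l ≤ h i)
    (h2 : l ≤ h (i - 1)) : g i - g (i - 1) ∈ tIdeal l :=
  tIdeal_anti (le_min h1 h2) (H.g_step i)

omit [NeZero n] in
theorem height_of_mem_upSteps (H : IsTreeWalk I J h g) {l : ℤ} {s : ZMod n}
    (hs : s ∈ upSteps I J h l) : h s = l + 1 := by
  rw [upSteps, Finset.mem_filter] at hs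
  have h1 := H.h_step s
  rcases indic_sub_indic_cases I J s with h2 | h2 | h2
  · omega
  · exact absurd (Finset.mem_sdiff.1 hs.1).1 (Finset.mem_sdiff.1 h2.1).2
  · exact absurd hs.1 h2.1

/-- The part of the walk above height `l` is, up to `t ^ (l + 1) ℂ⟦t⟧`, at the balls at which this
region is entered. -/
theorem exists_upStep (H : IsTreeWalk I J h g) {l : ℤ} (hl : ∃ j, h j ≤ l) {i : ZMod n}
    (hi : l < h i) : ∃ s ∈ upSteps I J h l, g i - g s ∈ tIdeal (l + 1) := by
  refine arc_induction (S := fun i => l < h i)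
    (P := fun i => ∃ s ∈ upSteps I J h l, g i - g s ∈ tIdeal (l + 1))
    (hl.imp fun j hj => not_lt.2 hj) (fun i hi hi' => ⟨i, ?_, ?_⟩) (fun i hi hi' hP => ?_) i hi
  · have h1 := H.h_step i
    rw [upSteps, Finset.mem_filter]
    rcases indic_sub_indic_cases I J i with h2 | h2 | h2
    · exact ⟨h2.1, by omega⟩
    · omega
    · omega
  · rw [sub_self]; exact zero_mem _
  · obtain ⟨s, hs, hgs⟩ := hP
    refine ⟨s, hs, ?_⟩
    rw [← sub_add_sub_cancel (g i) (g (i - 1))]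
    exact add_mem (H.sub_mem_of_le hi hi') hgs

/-- The steps telescope round the cycle: a walk that never drops below height `l` stays inside one
ball of height `l`. -/
theorem sub_mem_of_forall_le (H : IsTreeWalk I J h g) {l : ℤ} (hl : ∀ i, l ≤ h i)
    (i j : ZMod n) : g i - g j ∈ tIdeal l := by
  by_cases hij : i = j
  · rw [hij, sub_self]; exact zero_mem _
  · refine arc_induction (S := fun i => i ≠ j) (P := fun i => g i - g j ∈ tIdeal l)
      ⟨j, fun h => h rfl⟩ (fun i _ hi' => ?_) (fun i _ _ hP => ?_) i hij
    · rw [← not_ne_iff.1 hi']; exact H.sub_mem_of_le (hl _) (hl _)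
    · rw [← sub_add_sub_cancel (g i) (g (i - 1))]
      exact add_mem (H.sub_mem_of_le (hl _) (hl _)) hP

-- An up step has one starting height, so the sets for different heights are disjoint. With three up
-- steps in all, four consecutive heights suffice to determine the shape of the walk.
omit [NeZero n] in
theorem card_upSteps_le (T : ℤ) :
    (upSteps I J h T).card + (upSteps I J h (T + 1)).card + (upSteps I J h (T + 2)).card +
      (upSteps I J h (T + 3)).card ≤ (J \ I).card := by
  classical
  have hd : ∀ l l', l ≠ l' → Disjoint (upSteps I J h l) (upSteps I J h l') := by
    intro l l' hne
    rw [Finset.disjoint_left]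
    intro i hi hi'
    rw [upSteps, Finset.mem_filter] at hi hi'
    exact hne (hi.2.symm.trans hi'.2)
  rw [← Finset.card_union_of_disjoint (hd _ _ (by omega)), ← Finset.card_union_of_disjoint,
    ← Finset.card_union_of_disjoint]
  · refine Finset.card_le_card ?_
    simp [Finset.union_subset_iff, upSteps, Finset.filter_subset]
  all_goals
    simp only [Finset.disjoint_union_left]
    refine ⟨?_, hd _ _ (by omega)⟩
    first
      | exact hd _ _ (by omega)
      | exact ⟨hd _ _ (by omega), hd _ _ (by omega)⟩

/-- A closed walk with six steps in a tree stays in the star of one of its vertices or in a path. -/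
theorem star_or_path (H : IsTreeWalk I J h g) (hcard : (J \ I).card = 3) :
    (∃ c, ∀ i, h c - 1 ≤ h i ∧ h i ≤ h c + 1 ∧ g i - g c ∈ tIdeal (min (h i) (h c))) ∨
      ∃ z z' : ℂ⸨X⸩, ∃ T : ℤ, z - z' ∈ tIdeal T ∧ ∀ i, (g i - z ∈ tIdeal (h i) ∧ T ≤ h i) ∨
        (g i - z' ∈ tIdeal (h i) ∧ T ≤ h i ∧ h i ≤ T + 1) := by
  classical
  obtain ⟨i0, hmin⟩ := Finite.exists_min h
  obtain ⟨T, hT⟩ : ∃ T, h i0 = T := ⟨_, rfl⟩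
  rw [hT] at hmin
  have hsub : ∀ {x y w : ℂ⸨X⸩} {l : ℤ}, x - w ∈ tIdeal l → y - w ∈ tIdeal l →
      x - y ∈ tIdeal l := by
    intro x y w l hx hy
    have := sub_mem hx hy
    rwa [sub_sub_sub_cancel_right] at this
  -- At the minimal height `T` the walk only visits one ball.
  have hconst := H.sub_mem_of_forall_le hmin
  have hlow : ∀ l, T ≤ l → ∃ j, h j ≤ l := fun l hl => ⟨i0, by omega⟩
  have hcards := card_upSteps_le (I := I) (J := J) (h := h) T
  rw [hcard] at hcards
  have hpos : ∀ l, T ≤ l → ∀ i, l < h i → 0 < (upSteps I J h l).card := by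
    intro l hl i hi
    obtain ⟨s, hs, _⟩ := H.exists_upStep (hlow l hl) hi
    exact Finset.card_pos.2 ⟨s, hs⟩
  by_cases h1 : ∀ i, h i ≤ T + 1
  · refine Or.inl ⟨i0, fun i => ?_⟩
    have := hmin i
    have := h1 i
    refine ⟨by omega, by omega, tIdeal_anti ?_ (hconst i i0)⟩
    rw [hT]; exact min_le_right _ _
  push Not at h1
  obtain ⟨i1, hi1⟩ := h1
  have hp := hpos T le_rfl i1 (by omega)
  have hq := hpos (T + 1) (by omega) i1 (by omega)
  -- A visit above `T + 1` needs an up step from `T` and one from `T + 1`, so at most two of the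
  -- three start at `T`.
  by_cases h2 : (upSteps I J h T).card = 1
  · obtain ⟨s0, hs0⟩ := Finset.card_eq_one.1 h2
    have hs0' : h s0 = T + 1 := H.height_of_mem_upSteps (by rw [hs0]; simp)
    have r0 : ∀ i, T < h i → g i - g s0 ∈ tIdeal (T + 1) := by
      intro i hi
      obtain ⟨s, hs, hgs⟩ := H.exists_upStep (hlow T le_rfl) hi
      rw [hs0, Finset.mem_singleton] at hs
      rwa [hs] at hgs
    by_cases h3 : ∀ i, h i ≤ T + 2
    · refine Or.inl ⟨s0, fun i => ?_⟩
      have a1 := hmin i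
      have a2 := h3 i
      refine ⟨by omega, by omega, ?_⟩
      rcases eq_or_lt_of_le a1 with a3 | a3
      · exact tIdeal_anti (by rw [← a3]; exact min_le_left _ _) (hconst i s0)
      · exact tIdeal_anti (by rw [hs0']; exact min_le_right _ _) (r0 i a3)
    · push Not at h3
      obtain ⟨i2, hi2⟩ := h3
      have hr := hpos (T + 2) (by omega) i2 (by omega)
      -- One up step from each of `T`, `T + 1`, `T + 2`: the balls form a chain, and all of them
      -- contain `g s2`.
      obtain ⟨s1, hs1⟩ := Finset.card_eq_one.1 (show (upSteps I J h (T + 1)).card = 1 by omega)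
      obtain ⟨s2, hs2⟩ := Finset.card_eq_one.1 (show (upSteps I J h (T + 2)).card = 1 by omega)
      have hs2' : h s2 = T + 2 + 1 := H.height_of_mem_upSteps (by rw [hs2]; simp)
      have r1 : ∀ i, T + 1 < h i → g i - g s1 ∈ tIdeal (T + 1 + 1) := by
        intro i hi
        obtain ⟨s, hs, hgs⟩ := H.exists_upStep (hlow (T + 1) (by omega)) hi
        rw [hs1, Finset.mem_singleton] at hs
        rwa [hs] at hgs
      have r2 : ∀ i, T + 2 < h i → g i - g s2 ∈ tIdeal (T + 2 + 1) := by
        intro i hi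
        obtain ⟨s, hs, hgs⟩ := H.exists_upStep (hlow (T + 2) (by omega)) hi
        rw [hs2, Finset.mem_singleton] at hs
        rwa [hs] at hgs
      have h4 : ∀ i, h i ≤ T + 3 := by
        intro i
        by_contra hi
        have := hpos (T + 3) (by omega) i (by omega)
        omega
      refine Or.inr ⟨g s2, g s2, T, by rw [sub_self]; exact zero_mem _, fun i => Or.inl ⟨?_, hmin i⟩⟩
      have a1 := hmin i
      have a2 := h4 i
      obtain a | a | a | a : h i = T ∨ h i = T + 1 ∨ h i = T + 1 + 1 ∨ h i = T + 2 + 1 := by omega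
      · rw [a]; exact hconst i s2
      · rw [a]; exact hsub (r0 i (by omega)) (r0 s2 (by omega))
      · rw [a]; exact hsub (r1 i (by omega)) (r1 s2 (by omega))
      · rw [a]; exact r2 i (by omega)
  · obtain ⟨s1, s2, _, hs12⟩ := Finset.card_eq_two.1 (show (upSteps I J h T).card = 2 by omega)
    obtain ⟨s, hs⟩ := Finset.card_eq_one.1 (show (upSteps I J h (T + 1)).card = 1 by omega)
    have hs' : h s = T + 1 + 1 := H.height_of_mem_upSteps (by rw [hs]; simp)
    have r0 : ∀ i, T < h i → g i - g s1 ∈ tIdeal (T + 1) ∨ g i - g s2 ∈ tIdeal (T + 1) := by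
      intro i hi
      obtain ⟨s, hs, hgs⟩ := H.exists_upStep (hlow T le_rfl) hi
      rw [hs12, Finset.mem_insert, Finset.mem_singleton] at hs
      rcases hs with rfl | rfl
      · exact Or.inl hgs
      · exact Or.inr hgs
    have r1 : ∀ i, T + 1 < h i → g i - g s ∈ tIdeal (T + 1 + 1) := by
      intro i hi
      obtain ⟨s', hs', hgs⟩ := H.exists_upStep (hlow (T + 1) (by omega)) hi
      rw [hs, Finset.mem_singleton] at hs'
      rwa [hs'] at hgs
    have h4 : ∀ i, h i ≤ T + 2 := by
      intro i
      by_contra hi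
      have := hpos (T + 2) (by omega) i (by omega)
      omega
    -- Two up steps from `T` and one from `T + 1`: the ball at `T + 2` lies above one of the two
    -- entry balls at `T + 1`, and `s'` enters the other. This is a path bending at height `T`.
    obtain ⟨s', hs'⟩ : ∃ s', ∀ i, T < h i → g i - g s ∈ tIdeal (T + 1) ∨
        g i - g s' ∈ tIdeal (T + 1) := by
      rcases r0 s (by omega) with a | a
      · exact ⟨s2, fun i hi => (r0 i hi).imp (fun b => hsub b a) id⟩
      · exact ⟨s1, fun i hi => (r0 i hi).symm.imp (fun b => hsub b a) id⟩
    refine Or.inr ⟨g s, g s', T, hconst s s', fun i => ?_⟩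
    have a1 := hmin i
    have a2 := h4 i
    obtain a | a | a : h i = T ∨ h i = T + 1 ∨ h i = T + 1 + 1 := by omega
    · rw [a]; exact Or.inl ⟨hconst i s, le_rfl⟩
    · rw [a]
      exact (hs' i (by omega)).imp (fun b => ⟨b, by omega⟩) (fun b => ⟨b, by omega, by omega⟩)
    · rw [a]; exact Or.inl ⟨r1 i (by omega), by omega⟩

/-- Inside the star of a vertex, a closed walk with six steps leaves the centre three times. -/
theorem card_leave_center (H : IsTreeWalk I J h g) (hJI : (J \ I).card = 3)
    (hIJ : (I \ J).card = 3) {c : ℤ} (hc : ∀ i, c - 1 ≤ h i ∧ h i ≤ c + 1) :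
    (Finset.univ.filter fun i => h i ≠ c ∧ ¬ h (i - 1) ≠ c).card = 3 := by
  classical
  have h1 := card_enter_eq_card_leave fun i => h i ≠ c
  -- Heights stay within `1` of `c`, so each of the six moves has exactly one end at height `c`: it
  -- leaves or returns, and the two happen equally often.
  have h2 : (Finset.univ.filter fun i => h i ≠ c ∧ ¬ h (i - 1) ≠ c) ∪
      (Finset.univ.filter fun i => ¬ h i ≠ c ∧ h (i - 1) ≠ c) = (J \ I) ∪ (I \ J) := by
    ext i
    simp only [Finset.mem_union, Finset.mem_filter, Finset.mem_univ, true_and]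
    have a1 := hc i
    have a2 := hc (i - 1)
    have a3 := H.h_step i
    rcases indic_sub_indic_cases I J i with h2 | h2 | h2
    · exact iff_of_true (by omega) (Or.inl h2.1)
    · exact iff_of_true (by omega) (Or.inr h2.1)
    · exact iff_of_false (by omega) (by rintro (h3 | h3); exacts [h2.1 h3, h2.2.1 h3])
  have h3 := congrArg Finset.card h2
  rw [Finset.card_union_of_disjoint, Finset.card_union_of_disjoint, hJI, hIJ] at h3
  · omega
  · rw [Finset.disjoint_left]
    intro i hi hi'
    exact (Finset.mem_sdiff.1 hi').2 (Finset.mem_sdiff.1 hi).1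
  · rw [Finset.disjoint_left]
    intro i hi hi'
    exact (Finset.mem_filter.1 hi').2.1 (Finset.mem_filter.1 hi).2.1

end IsTreeWalk

end Walk

/-! ### Splitting modules whose lattices lie in one apartment. -/

namespace TriangularModel

variable {k n : ℕ} [NeZero n] {M : Type*} [AddCommGroup M] [Module ℂ⟦X⟧ M]
  {A : BAction k n M} {I J : Finset (ZMod n)}

theorem isTreeWalk (X : TriangularModel A I J) :
    IsTreeWalk I J (fun i => X.b i - X.a i) X.g where
  h_step i := by rw [X.a_step i, X.b_step i]; ring
  g_step := X.g_step

/-- The elements of the lattice spanned by `t ^ b (1, 0)` and `t ^ a (g, 1)`. -/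
def InLattice (a b : ℤ) (g p q : ℂ⸨X⸩) : Prop := q ∈ tIdeal a ∧ p - g * q ∈ tIdeal b

theorem InLattice.sub {a b : ℤ} {g p q p' q' : ℂ⸨X⸩} (h : InLattice a b g p q)
    (h' : InLattice a b g p' q') : InLattice a b g (p - p') (q - q') := by
  refine ⟨sub_mem h.1 h'.1, ?_⟩
  have := sub_mem h.2 h'.2
  rwa [show p - p' - g * (q - q') = p - g * q - (p' - g * q') by ring]

/-- The submodule cut out by a linear functional on `ℂ((t))^2`. -/
def kerSubmodule (X : TriangularModel A I J) (m₀ m₁ : ℂ⸨X⸩) : Submodule ℂ⟦X⟧ M where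
  carrier := {v | ∀ i, m₀ * X.F v i 0 + m₁ * X.F v i 1 = 0}
  zero_mem' i := by simp
  add_mem' {v w} hv hw i := by
    have h1 := hv i
    have h2 := hw i
    simp only [map_add, Pi.add_apply]
    linear_combination h1 + h2
  smul_mem' c v hv i := by
    have h1 := hv i
    simp only [map_smul, Pi.smul_apply, Algebra.smul_def]
    linear_combination algebraMap ℂ⟦X⟧ ℂ⸨X⸩ c * h1

theorem kerSubmodule_isStable (X : TriangularModel A I J) (m₀ m₁ : ℂ⸨X⸩) :
    A.IsStable (X.kerSubmodule m₀ m₁) := by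
  refine ⟨fun i v hv j => ?_, fun v hv j => ?_, fun v hv j => ?_⟩
  · rw [X.map_e]
    split_ifs
    · exact hv j
    · simp
  · rw [X.map_x, X.map_x]
    linear_combination tPow (1 - levelShift k j) * hv (j - 1)
  · have h0 := X.map_y v (j + 1) 0
    have h1 := X.map_y v (j + 1) 1
    rw [add_sub_cancel_right] at h0 h1
    rw [h0, h1]
    linear_combination tPow (levelShift k (j + 1)) * hv (j + 1)

/-- A functional vanishing on both generators of a lattice is zero. This makes both summands proper
when a module is split. -/
theorem eq_zero_of_kerSubmodule_eq_top (X : TriangularModel A I J) {m₀ m₁ : ℂ⸨X⸩}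
    (h : X.kerSubmodule m₀ m₁ = ⊤) : m₀ = 0 ∧ m₁ = 0 := by
  have key : ∀ p q : ZMod n → ℂ⸨X⸩, (∀ i, InLattice (X.a i) (X.b i) (X.g i) (p i) (q i)) →
      m₀ * p 0 + m₁ * q 0 = 0 := by
    intro p q hpq
    obtain ⟨v, hv⟩ := (X.mem_range fun i => ![p i, q i]).2 hpq
    have h1 : v ∈ X.kerSubmodule m₀ m₁ := h ▸ Submodule.mem_top
    have h2 := h1 0
    rw [hv] at h2
    simpa using h2
  have h0 : m₀ = 0 := by
    have := key (fun i => tPow (X.b i)) (fun _ => 0) fun i =>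
      ⟨zero_mem _, by rw [mul_zero, sub_zero]; exact tPow_mem_tIdeal _⟩
    rw [mul_zero, add_zero] at this
    exact (mul_eq_zero.1 this).resolve_right (tPow_ne_zero _)
  refine ⟨h0, ?_⟩
  have := key (fun i => X.g i * tPow (X.a i)) (fun i => tPow (X.a i)) fun i =>
    ⟨tPow_mem_tIdeal _, by rw [sub_self]; exact zero_mem _⟩
  rw [h0, zero_mul, zero_add] at this
  exact (mul_eq_zero.1 this).resolve_right (tPow_ne_zero _)

/-- A module all of whose lattices split along the same two lines of `ℂ((t))^2` decomposes. -/
theorem not_isIndecomposable_of_split (X : TriangularModel A I J) {m₀ m₁ l₀ l₁ : ℂ⸨X⸩}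
    (hdet : m₀ * l₁ - m₁ * l₀ ≠ 0)
    (hsplit : ∀ i p q, InLattice (X.a i) (X.b i) (X.g i) p q →
      ∃ p' q', InLattice (X.a i) (X.b i) (X.g i) p' q' ∧ m₀ * p' + m₁ * q' = 0 ∧
        l₀ * (p - p') + l₁ * (q - q') = 0) : ¬ A.IsIndecomposable := by
  intro hind
  have hc : IsCompl (X.kerSubmodule m₀ m₁) (X.kerSubmodule l₀ l₁) := by
    constructor
    · rw [Submodule.disjoint_def]
      intro v hv hv'
      apply X.injective
      rw [map_zero]
      ext1 i
      have h1 := hv i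
      have h2 := hv' i
      have e0 : X.F v i 0 = 0 := (mul_eq_zero.1 (show (m₀ * l₁ - m₁ * l₀) * X.F v i 0 = 0 by
        linear_combination l₁ * h1 - m₁ * h2)).resolve_left hdet
      have e1 : X.F v i 1 = 0 := (mul_eq_zero.1 (show (m₀ * l₁ - m₁ * l₀) * X.F v i 1 = 0 by
        linear_combination m₀ * h2 - l₀ * h1)).resolve_left hdet
      ext1 l
      fin_cases l
      · exact e0
      · exact e1
    · rw [codisjoint_iff, eq_top_iff]
      intro v _
      choose p q hpq h1 h2 using fun i =>
        hsplit i (X.F v i 0) (X.F v i 1) ((X.mem_range _).1 ⟨v, rfl⟩ i)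
      obtain ⟨w, hw⟩ := (X.mem_range fun i => ![p i, q i]).2 hpq
      refine Submodule.mem_sup.2 ⟨w, fun i => ?_, v - w, fun i => ?_, add_sub_cancel _ _⟩
      · rw [hw]; simpa using h1 i
      · rw [map_sub, hw]; simpa using h2 i
  rcases hind.2 _ _ (X.kerSubmodule_isStable _ _) (X.kerSubmodule_isStable _ _) hc with h | h
  · rw [h] at hc
    obtain ⟨rfl, rfl⟩ := X.eq_zero_of_kerSubmodule_eq_top (eq_top_of_bot_isCompl hc)
    simp at hdet
  · rw [h] at hc
    obtain ⟨rfl, rfl⟩ := X.eq_zero_of_kerSubmodule_eq_top (eq_top_of_isCompl_bot hc)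
    simp at hdet

/-- The projection of `(p, q)` to the line of `(z, 1)` along `(z', 1)` is `r (z, 1)` with `r = (p -
z'q)/(z - z')`. The hypotheses say that `z - z'` has order exactly `T`; as `p - z'q` has order at
least `a + T`, the coefficient `r` has order at least `a`. -/
theorem inLattice_line {a b T : ℤ} {g z z' p q : ℂ⸨X⸩} (hz : g - z ∈ tIdeal (b - a))
    (hT : T ≤ b - a) (hzz : z - z' ∈ tIdeal T) (hinv : (z - z')⁻¹ ∈ tIdeal (-T))
    (h : InLattice a b g p q) :
    InLattice a b g (z * ((p - z' * q) * (z - z')⁻¹)) ((p - z' * q) * (z - z')⁻¹) := by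
  have h1 : p - z' * q ∈ tIdeal (a + T) := by
    rw [show p - z' * q = p - g * q + (g - z) * q + (z - z') * q by ring]
    refine add_mem (add_mem ?_ ?_) ?_
    · exact tIdeal_anti (by omega) h.2
    · exact mul_mem_tIdeal_of_eq (tIdeal_anti hT hz) h.1 (add_comm _ _)
    · exact mul_mem_tIdeal_of_eq hzz h.1 (add_comm _ _)
  have h2 : (p - z' * q) * (z - z')⁻¹ ∈ tIdeal a := mul_mem_tIdeal_of_eq h1 hinv (by ring)
  refine ⟨h2, ?_⟩
  rw [show ∀ r, z * r - g * r = -((g - z) * r) by intro r; ring]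
  exact neg_mem (mul_mem_tIdeal_of_eq hz h2 (by ring))

/-- A module whose lattices lie on a path of the tree decomposes. -/
theorem not_isIndecomposable_of_path (X : TriangularModel A I J) {z z' : ℂ⸨X⸩} {T : ℤ}
    (hzz : z - z' ∈ tIdeal T)
    (H : ∀ i, (X.g i - z ∈ tIdeal (X.b i - X.a i) ∧ T ≤ X.b i - X.a i) ∨
      (X.g i - z' ∈ tIdeal (X.b i - X.a i) ∧ T ≤ X.b i - X.a i ∧ X.b i - X.a i ≤ T + 1)) :
    ¬ A.IsIndecomposable := by
  by_cases hT : z - z' ∈ tIdeal (T + 1)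
  · have hz : ∀ i, X.g i - z ∈ tIdeal (X.b i - X.a i) := by
      intro i
      rcases H i with h | h
      · exact h.1
      · rw [← sub_sub_sub_cancel_right _ _ z']
        exact sub_mem h.1 (tIdeal_anti h.2.2 hT)
    refine X.not_isIndecomposable_of_split (m₀ := 0) (m₁ := 1) (l₀ := 1) (l₁ := -z) (by simp) ?_
    intro i p q h
    refine ⟨p - z * q, 0, ⟨zero_mem _, ?_⟩, by ring, by ring⟩
    rw [show p - z * q - X.g i * 0 = p - X.g i * q + (X.g i - z) * q by ring]
    exact add_mem h.2 (mul_mem_tIdeal_of_eq (hz i) h.1 (by ring))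
  -- Now the branches to `z` and `z'` part exactly at height `T`, and the splitting lines are those
  -- of `(z, 1)` and `(z', 1)`.
  · have hinv := inv_mem_tIdeal hT
    have hne : z - z' ≠ 0 := fun h => hT (h ▸ zero_mem _)
    refine X.not_isIndecomposable_of_split (m₀ := 1) (m₁ := -z) (l₀ := 1) (l₁ := -z')
      (by intro h; apply hne; linear_combination h) ?_
    intro i p q h
    refine ⟨z * ((p - z' * q) * (z - z')⁻¹), (p - z' * q) * (z - z')⁻¹, ?_, by ring, ?_⟩
    · rcases H i with h' | h'
      · exact inLattice_line h'.1 h'.2 hzz hinv h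
      · have hzz' : z' - z ∈ tIdeal T := by rw [← neg_sub]; exact neg_mem hzz
        have hinv' : (z' - z)⁻¹ ∈ tIdeal (-T) := by
          rw [inv_eq_of_mul_eq_one_right (b := -(z - z')⁻¹)
            (by rw [← mul_inv_cancel₀ hne]; ring)]
          exact neg_mem hinv
        -- When the ball contains `z'`, the component along `(z', 1)` lies in the lattice, hence so
        -- does the complementary one.
        have h2 := h.sub (inLattice_line h'.1 h'.2.1 hzz' hinv' h)
        have hne' : z' - z ≠ 0 := by rw [← neg_sub]; exact neg_ne_zero.2 hne
        convert h2 using 1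
        · field_simp
          ring
        · field_simp
          ring
    · field_simp
      ring

end TriangularModel

/-! ### Homogeneous lattices near a central one. -/

section LevelSpace

/-- The filtration of `ℂ^2` that jumps from `0` to `ℓ` to `ℂ^2` around the level `s`. -/
def levelSpace (s : ℤ) (ℓ : Submodule ℂ (Fin 2 → ℂ)) (m : ℤ) : Submodule ℂ (Fin 2 → ℂ) :=
  if m < s then ⊥ else if m = s then ℓ else ⊤

theorem finrank_levelSpace_eq_one_iff {s m : ℤ} {ℓ : Submodule ℂ (Fin 2 → ℂ)} :
    Module.finrank ℂ (levelSpace s ℓ m) = 1 ↔ m = s ∧ Module.finrank ℂ ℓ = 1 := by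
  rcases lt_trichotomy m s with h | rfl | h
  · have e : levelSpace s ℓ m = ⊥ := if_pos h
    rw [e, finrank_bot]
    exact iff_of_false (by omega) (by omega)
  · have e : levelSpace m ℓ m = ℓ := by rw [levelSpace, if_neg (lt_irrefl m), if_pos rfl]
    rw [e]
    simp
  · have e : levelSpace s ℓ m = ⊤ := by rw [levelSpace, if_neg (by omega), if_neg (by omega)]
    rw [e, finrank_top, Module.finrank_fin_fun]
    exact iff_of_false (by omega) (by omega)

theorem forall_mem_levelSpace_iff {s : ℤ} {ℓ : Submodule ℂ (Fin 2 → ℂ)} {f : Fin 2 → ℂ⸨X⸩} :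
    (∀ m, (fun l => (f l).coeff m) ∈ levelSpace s ℓ m) ↔
      f 0 ∈ tIdeal s ∧ f 1 ∈ tIdeal s ∧ (fun l => (f l).coeff s) ∈ ℓ := by
  constructor
  · intro h
    have h1 : ∀ m < s, ∀ l, (f l).coeff m = 0 := by
      intro m hm l
      have := h m
      rw [levelSpace, if_pos hm, Submodule.mem_bot] at this
      exact congrFun this l
    refine ⟨mem_tIdeal_iff.2 fun m hm => h1 m hm 0, mem_tIdeal_iff.2 fun m hm => h1 m hm 1, ?_⟩
    have := h s
    rwa [levelSpace, if_neg (lt_irrefl s), if_pos rfl] at this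
  · rintro ⟨h0, h1, h2⟩ m
    unfold levelSpace
    split_ifs with hm hm
    · rw [Submodule.mem_bot]
      ext1 l
      fin_cases l
      · exact mem_tIdeal_iff.1 h0 m hm
      · exact mem_tIdeal_iff.1 h1 m hm
    · rwa [hm]
    · exact Submodule.mem_top

theorem mem_tIdeal_succ_iff {s : ℤ} {x : ℂ⸨X⸩} :
    x ∈ tIdeal (s + 1) ↔ x ∈ tIdeal s ∧ x.coeff s = 0 := by
  simp only [mem_tIdeal_iff]
  constructor
  · intro h
    exact ⟨fun j hj => h j (by omega), h s (by omega)⟩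
  · rintro ⟨h1, h2⟩ j hj
    rcases eq_or_lt_of_le (Int.lt_add_one_iff.1 hj) with rfl | hj'
    · exact h2
    · exact h1 j hj'

theorem mem_span_pair_one {κ : ℂ} {f : Fin 2 → ℂ} :
    f ∈ Submodule.span ℂ {(![κ, 1] : Fin 2 → ℂ)} ↔ f 0 = κ * f 1 := by
  rw [Submodule.mem_span_singleton]
  constructor
  · rintro ⟨a, rfl⟩
    simp [mul_comm]
  · intro h
    refine ⟨f 1, ?_⟩
    ext1 l
    fin_cases l
    · simp [h, mul_comm]
    · simp

theorem mem_span_one_zero {f : Fin 2 → ℂ} :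
    f ∈ Submodule.span ℂ {(![1, 0] : Fin 2 → ℂ)} ↔ f 1 = 0 := by
  rw [Submodule.mem_span_singleton]
  constructor
  · rintro ⟨a, rfl⟩
    simp
  · intro h
    refine ⟨f 0, ?_⟩
    ext1 l
    fin_cases l
    · simp
    · simp [h]

open TriangularModel in
/-- In the basis of the central lattice of a star, each of its lattices is homogeneous. -/
theorem exists_levelSpace {a b a₀ b₀ : ℤ} {g g₀ : ℂ⸨X⸩} (h1 : b₀ - a₀ - 1 ≤ b - a)
    (h2 : b - a ≤ b₀ - a₀ + 1) (hg : g - g₀ ∈ tIdeal (min (b - a) (b₀ - a₀))) :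
    ∃ ℓ : Submodule ℂ (Fin 2 → ℂ), (Module.finrank ℂ ℓ = 1 ↔ b - a ≠ b₀ - a₀) ∧
      ∀ f : Fin 2 → ℂ⸨X⸩,
        InLattice a b g (tPow b₀ * f 0 + g₀ * (tPow a₀ * f 1)) (tPow a₀ * f 1) ↔
          ∀ m, (fun l => (f l).coeff m) ∈ levelSpace (min (a - a₀) (b - b₀)) ℓ m := by
  have hL : ∀ f : Fin 2 → ℂ⸨X⸩,
      InLattice a b g (tPow b₀ * f 0 + g₀ * (tPow a₀ * f 1)) (tPow a₀ * f 1) ↔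
        f 1 ∈ tIdeal (a - a₀) ∧ tPow b₀ * f 0 - (g - g₀) * (tPow a₀ * f 1) ∈ tIdeal b := by
    intro f
    rw [InLattice, tPow_mul_mem_tIdeal_iff]
    ring_nf
  obtain ⟨δ, hδ⟩ : ∃ δ, g - g₀ = δ := ⟨_, rfl⟩
  rw [hδ] at hg hL
  simp only [hL, forall_mem_levelSpace_iff]
  obtain h | h | h : b - a = b₀ - a₀ ∨ b - a = b₀ - a₀ + 1 ∨ b - a = b₀ - a₀ - 1 := by omega
  -- Equal heights: the lattice is homothetic to the central one, and no line occurs.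
  · refine ⟨⊤, ?_, fun f => ?_⟩
    · rw [finrank_top, Module.finrank_fin_fun]
      exact iff_of_false (by omega) (by omega)
    · rw [show min (a - a₀) (b - b₀) = a - a₀ by omega]
      have key : f 1 ∈ tIdeal (a - a₀) → δ * (tPow a₀ * f 1) ∈ tIdeal b := fun hf =>
        mul_mem_tIdeal_of_eq hg (mul_mem_tIdeal (tPow_mem_tIdeal a₀) hf) (by omega)
      have h0 : tPow b₀ * f 0 ∈ tIdeal b ↔ f 0 ∈ tIdeal (a - a₀) := by
        rw [tPow_mul_mem_tIdeal_iff, show b - b₀ = a - a₀ by omega]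
      constructor
      · rintro ⟨hf, hf'⟩
        exact ⟨h0.1 (((tIdeal b).sub_mem_iff_left (key hf)).1 hf'), hf, Submodule.mem_top⟩
      · rintro ⟨hf', hf, -⟩
        exact ⟨hf, sub_mem (h0.2 hf') (key hf)⟩
  -- A ball one step smaller inside the central ball is determined by the leading coefficient of `g
  -- - g₀`, which is the slope of the line.
  · refine ⟨Submodule.span ℂ {![δ.coeff (b₀ - a₀), 1]}, ?_, fun f => ?_⟩
    · rw [finrank_span_singleton (by intro h; simpa using congrFun h 1)]
      exact iff_of_true rfl (by omega)
    · rw [show min (a - a₀) (b - b₀) = a - a₀ by omega, mem_span_pair_one]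
      rw [min_eq_right (by omega)] at hg
      obtain ⟨κ, hκ⟩ : ∃ κ, δ.coeff (b₀ - a₀) = κ := ⟨_, rfl⟩
      rw [hκ]
      have hδ' : δ - HahnSeries.C κ * tPow (b₀ - a₀) ∈ tIdeal (b₀ - a₀ + 1) := by
        rw [mem_tIdeal_succ_iff]
        refine ⟨sub_mem hg ?_, ?_⟩
        · rw [HahnSeries.C_mul_eq_smul, mem_tIdeal_iff]
          intro j hj
          rw [HahnSeries.coeff_smul, mem_tIdeal_iff.1 (tPow_mem_tIdeal _) j hj, smul_zero]
        · rw [HahnSeries.C_mul_eq_smul, HahnSeries.coeff_sub, HahnSeries.coeff_smul, hκ]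
          simp [tPow]
      have hC : f 1 ∈ tIdeal (a - a₀) → HahnSeries.C κ * f 1 ∈ tIdeal (a - a₀) := by
        intro hf
        rw [HahnSeries.C_mul_eq_smul, mem_tIdeal_iff]
        intro j hj
        rw [HahnSeries.coeff_smul, mem_tIdeal_iff.1 hf j hj, smul_zero]
      have e : tPow b₀ * f 0 - δ * (tPow a₀ * f 1) = tPow b₀ * (f 0 - HahnSeries.C κ * f 1) -
          (δ - HahnSeries.C κ * tPow (b₀ - a₀)) * (tPow a₀ * f 1) := by
        have : tPow b₀ = tPow (b₀ - a₀) * tPow a₀ := by rw [← tPow_add, sub_add_cancel]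
        rw [this]; ring
      have key : f 1 ∈ tIdeal (a - a₀) →
          (δ - HahnSeries.C κ * tPow (b₀ - a₀)) * (tPow a₀ * f 1) ∈ tIdeal b := fun hf =>
        mul_mem_tIdeal_of_eq hδ' (mul_mem_tIdeal (tPow_mem_tIdeal a₀) hf) (by omega)
      have h0 : tPow b₀ * (f 0 - HahnSeries.C κ * f 1) ∈ tIdeal b ↔
          f 0 - HahnSeries.C κ * f 1 ∈ tIdeal (a - a₀) ∧
            (f 0).coeff (a - a₀) = κ * (f 1).coeff (a - a₀) := by
        rw [tPow_mul_mem_tIdeal_iff, show b - b₀ = a - a₀ + 1 by omega, mem_tIdeal_succ_iff,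
          HahnSeries.C_mul_eq_smul, HahnSeries.coeff_sub, HahnSeries.coeff_smul, sub_eq_zero,
          smul_eq_mul]
      rw [e]
      constructor
      · rintro ⟨hf, hf'⟩
        have h3 := h0.1 (((tIdeal b).sub_mem_iff_left (key hf)).1 hf')
        exact ⟨((tIdeal _).sub_mem_iff_left (hC hf)).1 h3.1, hf, h3.2⟩
      · rintro ⟨hf', hf, hc⟩
        exact ⟨hf, sub_mem (h0.2 ⟨sub_mem hf' (hC hf), hc⟩) (key hf)⟩
  -- The unique ball one step larger corresponds to the line at infinity.
  · refine ⟨Submodule.span ℂ {![1, 0]}, ?_, fun f => ?_⟩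
    · rw [finrank_span_singleton (by intro h; simpa using congrFun h 0)]
      exact iff_of_true rfl (by omega)
    · rw [show min (a - a₀) (b - b₀) = b - b₀ by omega, mem_span_one_zero,
        show a - a₀ = b - b₀ + 1 by omega, mem_tIdeal_succ_iff]
      have key : f 1 ∈ tIdeal (b - b₀ + 1) → δ * (tPow a₀ * f 1) ∈ tIdeal b := fun hf =>
        mul_mem_tIdeal_of_eq hg (mul_mem_tIdeal (tPow_mem_tIdeal a₀) hf) (by omega)
      constructor
      · rintro ⟨hf, hf'⟩
        have h3 := ((tIdeal b).sub_mem_iff_left (key (mem_tIdeal_succ_iff.2 hf))).1 hf'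
        exact ⟨tPow_mul_mem_tIdeal_iff.1 h3, hf.1, hf.2⟩
      · rintro ⟨hf', hf, hc⟩
        exact ⟨⟨hf, hc⟩, sub_mem (tPow_mul_mem_tIdeal_iff.2 hf')
          (key (mem_tIdeal_succ_iff.2 ⟨hf, hc⟩))⟩

end LevelSpace

/-! ### The poset of a star and its components. -/

namespace TriangularModel

variable {k n : ℕ} [NeZero n] {M : Type*} [AddCommGroup M] [Module ℂ⟦X⟧ M]
  {A : BAction k n M} {I J : Finset (ZMod n)}

omit [NeZero n] in
theorem arrowX_eq (k : ℕ) (p : ZMod n × ℤ) :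
    arrowX k p = (p.1 + 1, p.2 + (1 - levelShift k (p.1 + 1))) := by
  unfold arrowX levelShift
  split_ifs <;> simp

omit [NeZero n] in
theorem arrowY_eq (k : ℕ) (p : ZMod n × ℤ) :
    arrowY k p = (p.1 - 1, p.2 + levelShift k p.1) := rfl

/-- The embedding of a module in the basis of its lattice at the vertex `c`. -/
noncomputable def centered (X : TriangularModel A I J) (c : ZMod n) :
    M →ₗ[ℂ⟦X⟧] (ZMod n → Fin 2 → ℂ⸨X⸩) where
  toFun v i := ![tPow (-X.b c) * (X.F v i 0 - X.g c * X.F v i 1), tPow (-X.a c) * X.F v i 1]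
  map_add' v w := by
    ext1 i; ext1 l
    fin_cases l <;> simp <;> ring
  map_smul' r v := by
    ext1 i; ext1 l
    fin_cases l <;> simp [Algebra.smul_def] <;> ring

theorem centered_zero (X : TriangularModel A I J) (c : ZMod n) (v : M) (i : ZMod n) :
    X.centered c v i 0 = tPow (-X.b c) * (X.F v i 0 - X.g c * X.F v i 1) := rfl

theorem centered_one (X : TriangularModel A I J) (c : ZMod n) (v : M) (i : ZMod n) :
    X.centered c v i 1 = tPow (-X.a c) * X.F v i 1 := rfl

theorem tPow_mul_centered_one (X : TriangularModel A I J) (c : ZMod n) (v : M) (i : ZMod n) :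
    tPow (X.a c) * X.centered c v i 1 = X.F v i 1 := by
  rw [centered_one, ← mul_assoc, ← tPow_add, add_neg_cancel, tPow_zero, one_mul]

theorem tPow_mul_centered_zero (X : TriangularModel A I J) (c : ZMod n) (v : M) (i : ZMod n) :
    tPow (X.b c) * X.centered c v i 0 + X.g c * (tPow (X.a c) * X.centered c v i 1) =
      X.F v i 0 := by
  rw [tPow_mul_centered_one, centered_zero, ← mul_assoc, ← tPow_add, add_neg_cancel, tPow_zero,
    one_mul, sub_add_cancel]

theorem centered_injective (X : TriangularModel A I J) (c : ZMod n) :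
    Function.Injective (X.centered c) := by
  intro v w h
  apply X.injective
  ext1 i; ext1 l
  fin_cases l
  · change X.F v i 0 = X.F w i 0
    rw [← X.tPow_mul_centered_zero c, h, X.tPow_mul_centered_zero]
  · change X.F v i 1 = X.F w i 1
    rw [← X.tPow_mul_centered_one c, h, X.tPow_mul_centered_one]

theorem mem_range_centered (X : TriangularModel A I J) (c : ZMod n)
    (f : ZMod n → Fin 2 → ℂ⸨X⸩) : (∃ v, X.centered c v = f) ↔
      ∀ i, InLattice (X.a i) (X.b i) (X.g i)
        (tPow (X.b c) * f i 0 + X.g c * (tPow (X.a c) * f i 1)) (tPow (X.a c) * f i 1) := by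
  constructor
  · rintro ⟨v, rfl⟩ i
    rw [X.tPow_mul_centered_zero, X.tPow_mul_centered_one]
    exact (X.mem_range _).1 ⟨v, rfl⟩ i
  · intro h
    obtain ⟨v, hv⟩ := (X.mem_range fun i =>
      ![tPow (X.b c) * f i 0 + X.g c * (tPow (X.a c) * f i 1), tPow (X.a c) * f i 1]).2 h
    refine ⟨v, ?_⟩
    ext1 i; ext1 l
    fin_cases l
    · change X.centered c v i 0 = f i 0
      rw [centered_zero, hv]
      simp only [Matrix.cons_val_zero, Matrix.cons_val_one, add_sub_cancel_right]
      rw [← mul_assoc, tPow_neg_mul, one_mul]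
    · change X.centered c v i 1 = f i 1
      rw [centered_one, hv]
      change tPow (-X.a c) * (tPow (X.a c) * f i 1) = f i 1
      rw [← mul_assoc, tPow_neg_mul, one_mul]

theorem centered_e (X : TriangularModel A I J) (c i : ZMod n) (v : M) (j : ZMod n) :
    X.centered c (A.e i v) j = if j = i then X.centered c v j else 0 := by
  ext1 l
  have h := X.map_e i v j
  split_ifs at h ⊢
  · fin_cases l
    · change X.centered c _ j 0 = X.centered c _ j 0
      rw [centered_zero, centered_zero, h]
    · change X.centered c _ j 1 = X.centered c _ j 1
      rw [centered_one, centered_one, h]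
  · fin_cases l
    · change X.centered c _ j 0 = 0
      rw [centered_zero, h]; simp
    · change X.centered c _ j 1 = 0
      rw [centered_one, h]; simp

theorem centered_x (X : TriangularModel A I J) (c : ZMod n) (v : M) (i : ZMod n) (l : Fin 2) :
    X.centered c (A.x v) i l = tPow (1 - levelShift k i) * X.centered c v (i - 1) l := by
  fin_cases l
  · change X.centered c _ i 0 = _ * X.centered c _ _ 0
    rw [centered_zero, centered_zero, X.map_x, X.map_x]; ring
  · change X.centered c _ i 1 = _ * X.centered c _ _ 1
    rw [centered_one, centered_one, X.map_x]; ring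

theorem centered_y (X : TriangularModel A I J) (c : ZMod n) (v : M) (i : ZMod n) (l : Fin 2) :
    X.centered c (A.y v) (i - 1) l = tPow (levelShift k i) * X.centered c v i l := by
  fin_cases l
  · change X.centered c _ _ 0 = _ * X.centered c _ _ 0
    rw [centered_zero, centered_zero, X.map_y, X.map_y]; ring
  · change X.centered c _ _ 1 = _ * X.centered c _ _ 1
    rw [centered_one, centered_one, X.map_y]; ring

theorem coeffAt_centered_x (X : TriangularModel A I J) (c : ZMod n) (v : M) (p : ZMod n × ℤ) :
    coeffAt (X.centered c (A.x v)) (arrowX k p) = coeffAt (X.centered c v) p := by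
  ext1 l
  rw [arrowX_eq]
  simp only [coeffAt]
  rw [centered_x, coeff_tPow_mul, add_sub_cancel_right]

theorem coeffAt_centered_y (X : TriangularModel A I J) (c : ZMod n) (v : M) (p : ZMod n × ℤ) :
    coeffAt (X.centered c (A.y v)) (arrowY k p) = coeffAt (X.centered c v) p := by
  ext1 l
  rw [arrowY_eq]
  simp only [coeffAt]
  rw [centered_y, coeff_tPow_mul]

/-- The level at which the filtration of the vertex `i` jumps, in the basis at the vertex `c`. -/
def jump (X : TriangularModel A I J) (c i : ZMod n) : ℤ :=
  min (X.a i - X.a c) (X.b i - X.b c)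

/-- A module with all lattices in the star of the lattice at `c` comes from a poset. -/
theorem exists_posetRep (X : TriangularModel A I J) {c : ZMod n}
    (hc : ∀ i, X.b c - X.a c - 1 ≤ X.b i - X.a i ∧ X.b i - X.a i ≤ X.b c - X.a c + 1 ∧
      X.g i - X.g c ∈ tIdeal (min (X.b i - X.a i) (X.b c - X.a c))) :
    ∃ R : PosetRep k n 2, A.IsCoveredBy R ∧ ∀ p, Module.finrank ℂ (R.W p) = 1 ↔
      p.2 = X.jump c p.1 ∧ X.b p.1 - X.a p.1 ≠ X.b c - X.a c := by
  choose ℓ hℓ hf using fun i => exists_levelSpace (hc i).1 (hc i).2.1 (hc i).2.2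
  have hrange : ∀ f, (∃ v, X.centered c v = f) ↔
      ∀ p : ZMod n × ℤ, coeffAt f p ∈ levelSpace (X.jump c p.1) (ℓ p.1) p.2 := by
    intro f
    rw [X.mem_range_centered]
    constructor
    · intro h p
      exact (hf p.1 (f p.1)).1 (h p.1) p.2
    · intro h i
      exact (hf i (f i)).2 fun m => h (i, m)
  -- Each vector of a level space is a coefficient of a module element supported at `p` alone; the
  -- inclusions along arrows then follow from stability under `x` and `y`.
  have hlift : ∀ (p : ZMod n × ℤ), ∀ w ∈ levelSpace (X.jump c p.1) (ℓ p.1) p.2,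
      ∃ v, coeffAt (X.centered c v) p = w := by
    intro p w hw
    obtain ⟨f, hf⟩ : ∃ f : ZMod n → Fin 2 → ℂ⸨X⸩, ∀ q, coeffAt f q = if q = p then w else 0 := by
      refine ⟨fun j => if j = p.1 then fun l => HahnSeries.single p.2 (w l) else 0, fun q => ?_⟩
      ext1 l
      by_cases h1 : q.1 = p.1
      · by_cases h2 : q.2 = p.2
        · rw [if_pos (Prod.ext h1 h2)]
          simp [coeffAt, h1, h2]
        · rw [if_neg fun h => h2 (congrArg Prod.snd h)]
          simp [coeffAt, h1, HahnSeries.coeff_single_of_ne h2]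
      · rw [if_neg fun h => h1 (congrArg Prod.fst h)]
        simp [coeffAt, h1]
    obtain ⟨v, rfl⟩ := (hrange f).2 (by
      intro q
      rw [hf]
      split_ifs with h
      · rwa [h]
      · exact zero_mem _)
    exact ⟨v, by rw [hf, if_pos rfl]⟩
  refine ⟨⟨fun p => levelSpace (X.jump c p.1) (ℓ p.1) p.2, fun p w hw => ?_, fun p w hw => ?_,
    fun i => ⟨X.jump c i, fun m hm => if_pos hm⟩, fun i => ⟨X.jump c i + 1, fun m hm => ?_⟩⟩,
    ⟨X.centered c, X.centered_injective c, hrange, fun i v p => ?_, X.coeffAt_centered_x c,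
      X.coeffAt_centered_y c⟩, fun p => ?_⟩
  · obtain ⟨v, rfl⟩ := hlift p w hw
    rw [← X.coeffAt_centered_x]
    exact (hrange _).1 ⟨_, rfl⟩ _
  · obtain ⟨v, rfl⟩ := hlift p w hw
    rw [← X.coeffAt_centered_y]
    exact (hrange _).1 ⟨_, rfl⟩ _
  · simp only [levelSpace]
    rw [if_neg (by omega), if_neg (by omega)]
  · ext1 l
    simp only [coeffAt]
    rw [X.centered_e]
    split_ifs <;> rfl
  · rw [← hℓ]
    exact finrank_levelSpace_eq_one_iff

/-- A module with profile `I | J`, `|I \ J| = |J \ I| = 3`, and all lattices in the star of one of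
them has poset `(1^3, 2)`. -/
theorem hasPosetOneTwo_of_star (X : TriangularModel A I J) (hn : 1 < n)
    (hJI : (J \ I).card = 3) (hIJ : (I \ J).card = 3) {c : ZMod n}
    (hc : ∀ i, X.b c - X.a c - 1 ≤ X.b i - X.a i ∧ X.b i - X.a i ≤ X.b c - X.a c + 1 ∧
      X.g i - X.g c ∈ tIdeal (min (X.b i - X.a i) (X.b c - X.a c))) :
    A.HasPosetOneTwo 3 := by
  classical
  obtain ⟨R, hR, hfin⟩ := X.exists_posetRep hc
  refine ⟨R, hR, ?_⟩
  have hcard := X.isTreeWalk.card_leave_center hJI hIJ fun i => ⟨(hc i).1, (hc i).2.1⟩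
  let S : ZMod n → Prop := fun i => X.b i - X.a i ≠ X.b c - X.a c
  have hS : ∃ j, ¬ S j := ⟨c, fun h => h rfl⟩
  let vert : ∀ i, S i → {p : ZMod n × ℤ // Module.finrank ℂ (R.W p) = 1} :=
    fun i hi => ⟨(i, X.jump c i), (hfin _).2 ⟨rfl, hi⟩⟩
  have vert_eq : ∀ q : {p : ZMod n × ℤ // Module.finrank ℂ (R.W p) = 1}, ∃ h : S q.1.1,
      q = vert q.1.1 h := by
    intro q
    obtain ⟨h1, h2⟩ := (hfin q.1).1 q.2
    exact ⟨h2, Subtype.ext (Prod.ext rfl h1)⟩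
  -- Between consecutive positions off the centre the height cannot change, as passing from `c - 1`
  -- to `c + 1` would take two steps. Hence `a` and `b`, and with them the jump, shift together:
  -- along the arrow `x` if `i ∈ I`, and against `y` if not.
  have hadj : ∀ i (hi : S i) (hi' : S (i - 1)),
      R.lineGraph.Adj (vert (i - 1) hi') (vert i hi) := by
    intro i hi hi'
    have ha := X.a_step i
    have hb := X.b_step i
    have c1 := hc i
    have c2 := hc (i - 1)
    have hi2 : X.b i - X.a i ≠ X.b c - X.a c := hi
    have hi2' : X.b (i - 1) - X.a (i - 1) ≠ X.b c - X.a c := hi'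
    have hIJi : indic I i = indic J i := by
      rcases indic_sub_indic_cases I J i with h | h | h <;> omega
    have hs : X.jump c i = X.jump c (i - 1) + indic I i - levelShift k i := by
      unfold jump; omega
    rw [PosetRep.lineGraph, SimpleGraph.fromRel_adj]
    refine ⟨fun h => ?_, ?_⟩
    · have h1 : i - 1 = i := congrArg (fun q => q.1.1) h
      exact one_ne_zero_zmod hn (by simpa using h1)
    · by_cases hI : i ∈ I
      · refine Or.inl (Or.inl ?_)
        rw [indic, if_pos hI] at hs
        rw [arrowX_eq]
        refine Prod.ext ?_ ?_
        · simp [vert]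
        · simp only [vert, sub_add_cancel]
          omega
      · refine Or.inr (Or.inr ?_)
        rw [indic, if_neg hI] at hs
        rw [arrowY_eq]
        refine Prod.ext rfl ?_
        simp only [vert]
        omega
  obtain ⟨st, hst1, hst2⟩ := exists_arcStart hS
  -- The start of the arc is constant on components, so different excursions give different
  -- components.
  have hst : ∀ p q, R.lineGraph.Reachable p q → st p.1.1 = st q.1.1 := by
    rintro p q ⟨w⟩
    induction w with
    | nil => rfl
    | @cons p q r h _ ih =>
      rw [← ih]
      obtain ⟨hp, _⟩ := vert_eq p
      obtain ⟨hq, _⟩ := vert_eq q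
      have e1 : q.1.1 = p.1.1 + 1 → st p.1.1 = st q.1.1 := by
        intro e
        have e' : q.1.1 - 1 = p.1.1 := by rw [e, add_sub_cancel_right]
        rw [hst2 q.1.1 hq (by rwa [e']), e']
      have e2 : p.1.1 = q.1.1 + 1 → st p.1.1 = st q.1.1 := by
        intro e
        have e' : p.1.1 - 1 = q.1.1 := by rw [e, add_sub_cancel_right]
        rw [hst2 p.1.1 hp (by rwa [e']), e']
      rw [PosetRep.lineGraph, SimpleGraph.fromRel_adj] at h
      rcases h.2 with (h | h) | (h | h)
      · exact e1 (by rw [h]; rfl)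
      · exact e2 (by rw [h]; simp [arrowY])
      · exact e2 (by rw [h]; rfl)
      · exact e1 (by rw [h]; simp [arrowY])
  rw [← hcard, ← Nat.card_eq_finsetCard]
  symm
  -- Components correspond to the positions at which the walk leaves the centre.
  refine Nat.card_eq_of_bijective (fun i : {i // i ∈ Finset.univ.filter fun i =>
    X.b i - X.a i ≠ X.b c - X.a c ∧ ¬ X.b (i - 1) - X.a (i - 1) ≠ X.b c - X.a c} =>
      R.lineGraph.connectedComponentMk (vert i.1 (Finset.mem_filter.1 i.2).2.1)) ⟨?_, ?_⟩
  · rintro ⟨i, hi⟩ ⟨j, hj⟩ hij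
    have h := hst _ _ (SimpleGraph.ConnectedComponent.exact hij)
    have hi' := (Finset.mem_filter.1 hi).2
    have hj' := (Finset.mem_filter.1 hj).2
    have e1 : st i = i := hst1 i hi'.1 hi'.2
    have e2 : st j = j := hst1 j hj'.1 hj'.2
    refine Subtype.ext ?_
    change st i = st j at h
    exact e1.symm.trans (h.trans e2)
  · intro C
    induction C using SimpleGraph.ConnectedComponent.ind with
    | _ q =>
      obtain ⟨hq, hq'⟩ := vert_eq q
      rw [hq']
      refine arc_induction (S := S) (P := fun i => ∀ hi : S i, ∃ a : {i // i ∈ Finset.univ.filter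
        fun i => X.b i - X.a i ≠ X.b c - X.a c ∧ ¬ X.b (i - 1) - X.a (i - 1) ≠ X.b c - X.a c},
        R.lineGraph.connectedComponentMk (vert a.1 (Finset.mem_filter.1 a.2).2.1) =
          R.lineGraph.connectedComponentMk (vert i hi)) hS ?_ ?_ q.1.1 hq hq
      · intro i hi hi' _
        exact ⟨⟨i, Finset.mem_filter.2 ⟨Finset.mem_univ _, hi, hi'⟩⟩, rfl⟩
      · intro i hi hi' hP _
        obtain ⟨a, ha⟩ := hP hi'
        exact ⟨a, ha.trans (SimpleGraph.ConnectedComponent.sound (hadj i hi hi').reachable)⟩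

end TriangularModel

/-- An indecomposable module with profile `I | J`, `|I \ J| = 3`, has poset `(1^3, 2)`. -/
theorem hasPosetOneTwo_of_isIndecomposable {k n : ℕ} [NeZero n] {M : Type*} [AddCommGroup M]
    [Module ℂ⟦X⟧ M] (A : BAction k n M) (hk : k ≤ n) (hn : 1 < n) (hind : A.IsIndecomposable)
    {I J : Finset (ZMod n)} {hI : I.card = k} {hJ : J.card = k}
    (hprofile : A.HasProfile hk I J hI hJ) (hIJ : (I ∩ J).card + 3 = k) :
    A.HasPosetOneTwo 3 := by
  obtain ⟨X⟩ := exists_triangularModel A hk hprofile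
  have h1 : (I \ J).card = 3 := by
    have := Finset.card_sdiff_add_card_inter I J
    omega
  have h2 : (J \ I).card = 3 := by
    have := Finset.card_sdiff_add_card_inter J I
    rw [Finset.inter_comm] at this
    omega
  rcases X.isTreeWalk.star_or_path h2 with ⟨c, hc⟩ | ⟨z, z', T, hzz, H⟩
  · exact X.hasPosetOneTwo_of_star hn h2 h1 hc
  · exact absurd hind (X.not_isIndecomposable_of_path hzz H)

end GrassmannianCM

theorem proposition5p4 {k n : ℕ} [NeZero n] (hk : 1 < k) (hkn : 2 * k ≤ n)
    {M : Type*} [AddCommGroup M] [Module ℂ⟦X⟧ M] [Module.Free ℂ⟦X⟧ M] [Module.Finite ℂ⟦X⟧ M]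
    (A : GrassmannianCM.BAction k n M) (hrank : A.HasRank 2) (hind : A.IsIndecomposable)
    (I J : Finset (ZMod n)) (hI : I.card = k) (hJ : J.card = k)
    (hprofile : A.HasProfile (by omega) I J hI hJ) :
    (GrassmannianCM.CorrespondsToRealRoot k I J →
      ((I ∩ J).card : ℤ) = (k : ℤ) - 3 ∧ A.HasPosetOneTwo 3) ∧
    ∀ m : ℤ, ((I ∩ J).card : ℤ) = (k : ℤ) - 3 - m →
      GrassmannianCM.quadForm k (GrassmannianCM.multVector I J) = 2 - 2 * (m : ℚ) := by
  refine ⟨fun hroot => ?_, fun m hm => ?_⟩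
  · have h := GrassmannianCM.card_inter_of_correspondsToRealRoot (by omega) (by omega) (by omega)
      hI hJ hroot
    exact ⟨by omega, GrassmannianCM.hasPosetOneTwo_of_isIndecomposable A _ (by omega) hind
      hprofile h⟩
  · have h : ((I ∩ J).card : ℚ) = k - 3 - m := by exact_mod_cast hm
    rw [GrassmannianCM.quadForm_multVector (by omega) hI hJ, h]
    ring
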